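/- **System.** Fix a first-order language $\mathcal L$; formulas are built from $\bot$ and atoms by $\wedge,\vee,\to,\forall,\exists$, with $\neg A:=A\to\bot$. A formula is \emph{negative} if it is quantifier-free and $\vee$ does not occur in it, and \emph{simply universal} if it is $\forall\alpha_1\dots\forall\alpha_n P$ with $P$ negative ($n\ge 0$). The system $\mathsf{IL}+\mathsf{EM}_1^-$ assigns proof terms $$t,u,v::= x\mid tu\mid tm\mid \lambda x\,u\mid\lambda\alpha\,u\mid\langle t,u\rangle\mid\pi_iu\mid\iota_iu\mid t[x.u,y.v]\mid(m,t)\mid t[(\alpha,x).u]\mid u\parallel v\mid u\parallel_a v\mid \mathsf H_a^{\forall\alpha A}\mid\mathsf W_a^{\exists\alpha P}\mid\mathsf H^{P}$$ ($m$ a term of $\mathcal L$, $x$ a proof-term variable, $\alpha$ a first-order variable, $a$ a hypothesis variable, bound in $u\parallel_a v$) by the usual rules of natural deduction for first-order intuitionistic logic (without general ex falso, which is an axiom for negative formulas only), the axioms $$\Gamma,a:\forall\alpha A\vdash \mathsf H_a^{\forall\alpha A}:\forall\alpha A,\quad \Gamma,a:\exists\alpha P\vdash \mathsf W_a^{\exists\alpha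 P}:\exists\alpha P,\quad \Gamma,a:P\vdash\mathsf H^P:P,\quad \Gamma\vdash\mathsf H^{\bot\to P}:\bot\to P$$ ($A$ simply universal, $P$ negative) and the rules $$\frac{\Gamma,a:\neg P\vdash u:C\qquad\Gamma,a:P\vdash v:C}{\Gamma\vdash u\parallel v:C}\qquad\qquad \frac{\Gamma,a:\forall\alpha P\vdash u:\exists\beta Q\qquad \Gamma,a:\exists\alpha\neg P\vdash v:\exists\beta Q}{\Gamma\vdash u\parallel_a v:\exists\beta Q}$$ for $P,Q$ negative. The reduction relation $\mapsto$ is the closure under all term contexts of: the usual detour reductions $(\lambda x.u)t\mapsto u[t/x]$, $(\lambda\alpha.u)m\mapsto u[m/\alpha]$, $\pi_i\langle u_0,u_1\rangle\mapsto u_i$, $(\iota_iu)[x_0.t_0,x_1.t_1]\mapsto t_i[u/x_i]$, $(m,u)[(\alpha,x).v]\mapsto v[m/\alpha][u/x]$; the permutations $(u\parallel v)\,\xi\mapsto u\xi\parallel v\xi$ for every elimination $\xi$ (application to a proof term or to a first-order term, projection, case, existential elimination); and * $u\parallel_a v\mapsto u$ if $a$ is not free in $u$; * $u\parallel_a v\mapsto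 v[a:=m]\parallel(u[a:=m]\parallel_a v)$ if $u$ has a subterm $\mathsf H_a^{\forall\alpha P}m$ whose only free variable is $a$. Here $v[a:=m]$ replaces each free $\mathsf W_a^{\exists\alpha R}$ in $v$ by $(m,\mathsf H^{R[m/\alpha]})$, and $u[a:=m]$ replaces each free $\mathsf H_a^{\forall\alpha P}m$ in $u$ by $\mathsf H^{P[m/\alpha]}$. A term is \emph{normal} if no reduction step applies to it. A proof term is \emph{quasi-closed} if its only free variables are hypothesis variables $a$, each free occurrence of which is in a subterm $\mathsf H_a^{\forall\alpha A}$ with $\forall\alpha A$ simply universal (variables in the formulas that occur in the term count). \emph{Herbrand normal forms} are defined inductively: every normal term $(m,u)$ is one, and if $u$ and $v$ are, then so is $u\parallel v$. **Theorem (Herbrand Disjunction Extraction).** Let $\exists\alpha\,A$ be any closed formula. Suppose $\Gamma\vdash t:\exists\alpha\,A$ in $\mathsf{IL}+\mathsf{EM}_1^-$ for a quasi-closed term $t$, and $t\mapsto^* t'$ with $t'$ in normal form. Then $\Gamma\vdash t':\exists\alpha\,A$, and $t'$ is a Herbrand normal form, i.e. (up to bracketing) a parallel composition $$(m_0,u_0)\parallel(m_1,u_1)\parallel\dots\parallel(m_k,u_k)\qquad(k\ge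 0).$$ Moreover $A[m_0/\alpha]\vee A[m_1/\alpha]\vee\dots\vee A[m_k/\alpha]$ is derivable from $\Gamma$, i.e. $\Gamma\vdash s:A[m_0/\alpha]\vee\dots\vee A[m_k/\alpha]$ for some proof term $s$. -/

import Mathlib

universe u v

noncomputable section

namespace ILEM

/-! First-order syntax. All variables are de Bruijn indices. Terms are Mathlib's first-order
terms with variables in `ℕ`. -/

/-- First-order formulas with all intuitionistic connectives primitive, without equality.
`all A` and `ex A` bind the first-order variable `0` of `A`. -/
inductive Formula (L : FirstOrder.Language.{u, v}) : Type (max u v) where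
  | bot : Formula L
  | rel {n : ℕ} (R : L.Relations n) (ts : Fin n → L.Term ℕ) : Formula L
  | and (A B : Formula L) : Formula L
  | or (A B : Formula L) : Formula L
  | imp (A B : Formula L) : Formula L
  | all (A : Formula L) : Formula L
  | ex (A : Formula L) : Formula L

/-- Renaming of a first-order term that skips one newly bound first-order variable. -/
def liftTerm {L : FirstOrder.Language.{u, v}} (m : L.Term ℕ) : L.Term ℕ := m.relabel Nat.succ

/-- Extension of a first-order substitution under a first-order binder. -/
def upT {L : FirstOrder.Language.{u, v}} (σ : ℕ → L.Term ℕ) : ℕ → L.Term ℕ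
  | 0 => FirstOrder.Language.Term.var 0
  | n + 1 => liftTerm (σ n)

/-- The substitution of `m` for the first-order variable `0`, whose binder is removed. -/
def instT {L : FirstOrder.Language.{u, v}} (m : L.Term ℕ) : ℕ → L.Term ℕ
  | 0 => m
  | n + 1 => FirstOrder.Language.Term.var n

/-- The substitution that skips one newly bound first-order variable. -/
def shiftT {L : FirstOrder.Language.{u, v}} : ℕ → L.Term ℕ := fun n => FirstOrder.Language.Term.var (n + 1)

/-- All variables of the first-order term `m` are smaller than `k`. -/
def TermBelow {L : FirstOrder.Language.{u, v}} (k : ℕ) (m : L.Term ℕ) : Prop := ∀ i ∈ m.varFinset, i < k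

namespace Formula

variable {L : FirstOrder.Language.{u, v}}

/-- `¬ A`, that is `A → ⊥`. -/
def neg (A : Formula L) : Formula L := imp A bot

/-- Capture-avoiding simultaneous substitution of first-order terms. -/
def subst : (ℕ → L.Term ℕ) → Formula L → Formula L
  | _, bot => bot
  | σ, rel R ts => rel R (fun i => (ts i).subst σ)
  | σ, and A B => and (A.subst σ) (B.subst σ)
  | σ, or A B => or (A.subst σ) (B.subst σ)
  | σ, imp A B => imp (A.subst σ) (B.subst σ)
  | σ, all A => all (A.subst (upT σ))
  | σ, ex A => ex (A.subst (upT σ))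

/-- `A` read under one more first-order binder. -/
def lift (A : Formula L) : Formula L := A.subst shiftT

/-- `A[m/α]`, where `α` is the variable `0` of `A`. -/
def inst (A : Formula L) (m : L.Term ℕ) : Formula L := A.subst (instT m)

/-- All free first-order variables of the formula are smaller than `k`. -/
def Below : ℕ → Formula L → Prop
  | _, bot => True
  | k, rel _ ts => ∀ i, TermBelow k (ts i)
  | k, and A B => A.Below k ∧ B.Below k
  | k, or A B => A.Below k ∧ B.Below k
  | k, imp A B => A.Below k ∧ B.Below k
  | k, all A => A.Below (k + 1)
  | k, ex A => A.Below (k + 1)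

/-- A closed formula: one without free first-order variables. -/
def Closed (A : Formula L) : Prop := A.Below 0

/-- Negative propositional formulas: no quantifier and no `∨` occurs. -/
def Negative : Formula L → Prop
  | bot => True
  | rel _ _ => True
  | and A B => A.Negative ∧ B.Negative
  | or _ _ => False
  | imp A B => A.Negative ∧ B.Negative
  | all _ => False
  | ex _ => False

/-- Simply universal formulas `∀ α₁ … ∀ αₙ P` with `P` negative propositional, `n ≥ 0`. -/
def SimplyUniversal : Formula L → Prop
  | all A => A.SimplyUniversal
  | A => A.Negative

/-- `A₀ ∨ (A₁ ∨ (… ∨ Aₖ))`; by convention `⊥` for the empty list. -/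
def disj : List (Formula L) → Formula L
  | [] => bot
  | [A] => A
  | A :: B :: l => or A (disj (B :: l))

end Formula

/-! Proof terms. There are three independent kinds of variables, each with its own de Bruijn
indices: first-order variables `α`, proof-term variables `x`, hypothesis variables `a`. -/

/-- Untyped proof terms. -/
inductive PTerm (L : FirstOrder.Language.{u, v}) : Type (max u v) where
  /-- `x` -/
  | var (x : ℕ) : PTerm L
  /-- `t u` -/
  | app (t u : PTerm L) : PTerm L
  /-- `t m`, with `m` a first-order term -/
  | appT (t : PTerm L) (m : L.Term ℕ) : PTerm L
  /-- `λ x u` -/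
  | lam (u : PTerm L) : PTerm L
  /-- `λ α u` -/
  | lamT (u : PTerm L) : PTerm L
  /-- `⟨t, u⟩` -/
  | pair (t u : PTerm L) : PTerm L
  /-- `π₀ u` -/
  | fst (u : PTerm L) : PTerm L
  /-- `π₁ u` -/
  | snd (u : PTerm L) : PTerm L
  /-- `ι₀ u` -/
  | inl (u : PTerm L) : PTerm L
  /-- `ι₁ u` -/
  | inr (u : PTerm L) : PTerm L
  /-- `t [x.u, y.v]`; each of `u`, `v` binds a proof-term variable -/
  | case (t u v : PTerm L) : PTerm L
  /-- `(m, t)` -/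
  | enc (m : L.Term ℕ) (t : PTerm L) : PTerm L
  /-- `t [(α, x). u]`; `u` binds a first-order variable and a proof-term variable -/
  | dest (t u : PTerm L) : PTerm L
  /-- `u ∥ v`, the parallel operator; it binds nothing -/
  | par (u v : PTerm L) : PTerm L
  /-- `u ∥ₐ v`; the hypothesis variable `a` is bound in both `u` and `v` -/
  | em (u v : PTerm L) : PTerm L
  /-- the hypothesis term `H_a^{∀ α A}`; `α` is the first-order variable `0` of `A` -/
  | hyp (a : ℕ) (A : Formula L) : PTerm L
  /-- the witness term `W_a^{∃ α P}`; `α` is the first-order variable `0` of `P` -/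
  | wit (a : ℕ) (P : Formula L) : PTerm L
  /-- the constant `H^P` -/
  | hyp0 (P : Formula L) : PTerm L

namespace PTerm

variable {L : FirstOrder.Language.{u, v}}

/-- Extension of a renaming under a binder. -/
def upR (ρ : ℕ → ℕ) : ℕ → ℕ
  | 0 => 0
  | n + 1 => ρ n + 1

/-- Renaming of proof-term variables. -/
def renV : (ℕ → ℕ) → PTerm L → PTerm L
  | ρ, var x => var (ρ x)
  | ρ, app t u => app (t.renV ρ) (u.renV ρ)
  | ρ, appT t m => appT (t.renV ρ) m
  | ρ, lam t => lam (t.renV (upR ρ))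
  | ρ, lamT t => lamT (t.renV ρ)
  | ρ, pair t u => pair (t.renV ρ) (u.renV ρ)
  | ρ, fst t => fst (t.renV ρ)
  | ρ, snd t => snd (t.renV ρ)
  | ρ, inl t => inl (t.renV ρ)
  | ρ, inr t => inr (t.renV ρ)
  | ρ, case t u v => case (t.renV ρ) (u.renV (upR ρ)) (v.renV (upR ρ))
  | ρ, enc m t => enc m (t.renV ρ)
  | ρ, dest t u => dest (t.renV ρ) (u.renV (upR ρ))
  | ρ, par u v => par (u.renV ρ) (v.renV ρ)
  | ρ, em u v => em (u.renV ρ) (v.renV ρ)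
  | _, hyp a A => hyp a A
  | _, wit a P => wit a P
  | _, hyp0 P => hyp0 P

/-- Renaming of hypothesis variables. -/
def renH : (ℕ → ℕ) → PTerm L → PTerm L
  | _, var x => var x
  | ρ, app t u => app (t.renH ρ) (u.renH ρ)
  | ρ, appT t m => appT (t.renH ρ) m
  | ρ, lam t => lam (t.renH ρ)
  | ρ, lamT t => lamT (t.renH ρ)
  | ρ, pair t u => pair (t.renH ρ) (u.renH ρ)
  | ρ, fst t => fst (t.renH ρ)
  | ρ, snd t => snd (t.renH ρ)
  | ρ, inl t => inl (t.renH ρ)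
  | ρ, inr t => inr (t.renH ρ)
  | ρ, case t u v => case (t.renH ρ) (u.renH ρ) (v.renH ρ)
  | ρ, enc m t => enc m (t.renH ρ)
  | ρ, dest t u => dest (t.renH ρ) (u.renH ρ)
  | ρ, par u v => par (u.renH ρ) (v.renH ρ)
  | ρ, em u v => em (u.renH (upR ρ)) (v.renH (upR ρ))
  | ρ, hyp a A => hyp (ρ a) A
  | ρ, wit a P => wit (ρ a) P
  | _, hyp0 P => hyp0 P

/-- Capture-avoiding simultaneous substitution for first-order variables, in the first-order
terms and in the formulas that a proof term contains. -/
def substT : (ℕ → L.Term ℕ) → PTerm L → PTerm L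
  | _, var x => var x
  | σ, app t u => app (t.substT σ) (u.substT σ)
  | σ, appT t m => appT (t.substT σ) (m.subst σ)
  | σ, lam t => lam (t.substT σ)
  | σ, lamT t => lamT (t.substT (upT σ))
  | σ, pair t u => pair (t.substT σ) (u.substT σ)
  | σ, fst t => fst (t.substT σ)
  | σ, snd t => snd (t.substT σ)
  | σ, inl t => inl (t.substT σ)
  | σ, inr t => inr (t.substT σ)
  | σ, case t u v => case (t.substT σ) (u.substT σ) (v.substT σ)
  | σ, enc m t => enc (m.subst σ) (t.substT σ)
  | σ, dest t u => dest (t.substT σ) (u.substT (upT σ))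
  | σ, par u v => par (u.substT σ) (v.substT σ)
  | σ, em u v => em (u.substT σ) (v.substT σ)
  | σ, hyp a A => hyp a (A.subst (upT σ))
  | σ, wit a P => wit a (P.subst (upT σ))
  | σ, hyp0 P => hyp0 (P.subst σ)

/-- `t` read under one more binder of a proof-term variable. -/
def liftV (t : PTerm L) : PTerm L := t.renV Nat.succ

/-- `t` read under one more binder of a hypothesis variable. -/
def liftH (t : PTerm L) : PTerm L := t.renH Nat.succ

/-- `t` read under one more binder of a first-order variable. -/
def liftT (t : PTerm L) : PTerm L := t.substT shiftT

/-- Extension of a proof-term substitution under a binder of a proof-term variable. -/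
def upV (τ : ℕ → PTerm L) : ℕ → PTerm L
  | 0 => var 0
  | n + 1 => (τ n).liftV

/-- Capture-avoiding simultaneous substitution for proof-term variables. -/
def substV : (ℕ → PTerm L) → PTerm L → PTerm L
  | τ, var x => τ x
  | τ, app t u => app (t.substV τ) (u.substV τ)
  | τ, appT t m => appT (t.substV τ) m
  | τ, lam t => lam (t.substV (upV τ))
  | τ, lamT t => lamT (t.substV (fun n => (τ n).liftT))
  | τ, pair t u => pair (t.substV τ) (u.substV τ)
  | τ, fst t => fst (t.substV τ)
  | τ, snd t => snd (t.substV τ)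
  | τ, inl t => inl (t.substV τ)
  | τ, inr t => inr (t.substV τ)
  | τ, case t u v => case (t.substV τ) (u.substV (upV τ)) (v.substV (upV τ))
  | τ, enc m t => enc m (t.substV τ)
  | τ, dest t u => dest (t.substV τ) (u.substV (upV (fun n => (τ n).liftT)))
  | τ, par u v => par (u.substV τ) (v.substV τ)
  | τ, em u v => em (u.substV (fun n => (τ n).liftH)) (v.substV (fun n => (τ n).liftH))
  | _, hyp a A => hyp a A
  | _, wit a P => wit a P
  | _, hyp0 P => hyp0 P

/-- The substitution of `t` for the proof-term variable `0`, whose binder is removed. -/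
def singleV (t : PTerm L) : ℕ → PTerm L
  | 0 => t
  | n + 1 => var n

/-- `u[t/x]`, where `x` is the proof-term variable `0` of `u`. -/
def instV (u t : PTerm L) : PTerm L := u.substV (singleV t)

/-- `u[m/α]`, where `α` is the first-order variable `0` of `u`. -/
def instFO (u : PTerm L) (m : L.Term ℕ) : PTerm L := u.substT (instT m)

/-- Every free occurrence of the hypothesis variable `a` is in a subterm `H_a^{∀ α A}`. -/
def OnlyHyp : ℕ → PTerm L → Prop
  | _, var _ => True
  | a, app t u => t.OnlyHyp a ∧ u.OnlyHyp a
  | a, appT t _ => t.OnlyHyp a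
  | a, lam t => t.OnlyHyp a
  | a, lamT t => t.OnlyHyp a
  | a, pair t u => t.OnlyHyp a ∧ u.OnlyHyp a
  | a, fst t => t.OnlyHyp a
  | a, snd t => t.OnlyHyp a
  | a, inl t => t.OnlyHyp a
  | a, inr t => t.OnlyHyp a
  | a, case t u v => t.OnlyHyp a ∧ u.OnlyHyp a ∧ v.OnlyHyp a
  | a, enc _ t => t.OnlyHyp a
  | a, dest t u => t.OnlyHyp a ∧ u.OnlyHyp a
  | a, par u v => u.OnlyHyp a ∧ v.OnlyHyp a
  | a, em u v => u.OnlyHyp (a + 1) ∧ v.OnlyHyp (a + 1)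
  | _, hyp _ _ => True
  | a, wit b _ => b ≠ a
  | _, hyp0 _ => True

/-- Every free occurrence of the hypothesis variable `a` is in a subterm `W_a^{∃ α P}`. -/
def OnlyWit : ℕ → PTerm L → Prop
  | _, var _ => True
  | a, app t u => t.OnlyWit a ∧ u.OnlyWit a
  | a, appT t _ => t.OnlyWit a
  | a, lam t => t.OnlyWit a
  | a, lamT t => t.OnlyWit a
  | a, pair t u => t.OnlyWit a ∧ u.OnlyWit a
  | a, fst t => t.OnlyWit a
  | a, snd t => t.OnlyWit a
  | a, inl t => t.OnlyWit a
  | a, inr t => t.OnlyWit a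
  | a, case t u v => t.OnlyWit a ∧ u.OnlyWit a ∧ v.OnlyWit a
  | a, enc _ t => t.OnlyWit a
  | a, dest t u => t.OnlyWit a ∧ u.OnlyWit a
  | a, par u v => u.OnlyWit a ∧ v.OnlyWit a
  | a, em u v => u.OnlyWit (a + 1) ∧ v.OnlyWit (a + 1)
  | a, hyp b _ => b ≠ a
  | _, wit _ _ => True
  | _, hyp0 _ => True

/-- Index of the hypothesis variable `b ≠ a` after the binder of `a` has been removed. -/
def dropIdx (a b : ℕ) : ℕ := if a < b then b - 1 else b

/-- Exception substitution `v[a := m]` when `a` occurs in `v` only in subterms `W_a^{∃ α P}`: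
each of them is replaced by `(m, H^{P[m/α]})`. The binder of `a` is removed. -/
def catchWit : ℕ → L.Term ℕ → PTerm L → PTerm L
  | _, _, var x => var x
  | a, m, app t u => app (t.catchWit a m) (u.catchWit a m)
  | a, m, appT t n => appT (t.catchWit a m) n
  | a, m, lam t => lam (t.catchWit a m)
  | a, m, lamT t => lamT (t.catchWit a (liftTerm m))
  | a, m, pair t u => pair (t.catchWit a m) (u.catchWit a m)
  | a, m, fst t => fst (t.catchWit a m)
  | a, m, snd t => snd (t.catchWit a m)
  | a, m, inl t => inl (t.catchWit a m)
  | a, m, inr t => inr (t.catchWit a m)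
  | a, m, case t u v => case (t.catchWit a m) (u.catchWit a m) (v.catchWit a m)
  | a, m, enc n t => enc n (t.catchWit a m)
  | a, m, dest t u => dest (t.catchWit a m) (u.catchWit a (liftTerm m))
  | a, m, par u v => par (u.catchWit a m) (v.catchWit a m)
  | a, m, em u v => em (u.catchWit (a + 1) m) (v.catchWit (a + 1) m)
  | a, _, hyp b A => hyp (dropIdx a b) A
  | a, m, wit b P => if b = a then enc m (hyp0 (P.inst m)) else wit (dropIdx a b) P
  | _, _, hyp0 P => hyp0 P

open Classical in
/-- Exception substitution `u[a := m]` when `a` occurs in `u` only in subterms `H_a^{∀ α A}`: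
each subterm `H_a^{∀ α A} m` is replaced by `H^{A[m/α]}`. The other occurrences of `a` stay, and
so does the binder of `a`. -/
def raiseHyp : ℕ → L.Term ℕ → PTerm L → PTerm L
  | _, _, var x => var x
  | a, m, app t u => app (t.raiseHyp a m) (u.raiseHyp a m)
  | a, m, appT (hyp b A) n =>
      if b = a ∧ n = m then hyp0 (A.inst m) else appT (hyp b A) n
  | a, m, appT t n => appT (t.raiseHyp a m) n
  | a, m, lam t => lam (t.raiseHyp a m)
  | a, m, lamT t => lamT (t.raiseHyp a (liftTerm m))
  | a, m, pair t u => pair (t.raiseHyp a m) (u.raiseHyp a m)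
  | a, m, fst t => fst (t.raiseHyp a m)
  | a, m, snd t => snd (t.raiseHyp a m)
  | a, m, inl t => inl (t.raiseHyp a m)
  | a, m, inr t => inr (t.raiseHyp a m)
  | a, m, case t u v => case (t.raiseHyp a m) (u.raiseHyp a m) (v.raiseHyp a m)
  | a, m, enc n t => enc n (t.raiseHyp a m)
  | a, m, dest t u => dest (t.raiseHyp a m) (u.raiseHyp a (liftTerm m))
  | a, m, par u v => par (u.raiseHyp a m) (v.raiseHyp a m)
  | a, m, em u v => em (u.raiseHyp (a + 1) m) (v.raiseHyp (a + 1) m)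
  | _, _, hyp b A => hyp b A
  | _, _, wit b P => wit b P
  | _, _, hyp0 P => hyp0 P

/-- The term has a subterm `H_a^{∀ α P} m` that is active: its only free variable is `a`, that
is, `m` is closed and `P` has no free variable but `α`. -/
def HasActive (P : Formula L) (m : L.Term ℕ) : ℕ → PTerm L → Prop
  | _, var _ => False
  | a, app t u => t.HasActive P m a ∨ u.HasActive P m a
  | a, appT t n =>
      (t = hyp a P ∧ n = m ∧ TermBelow 0 m ∧ P.Below 1) ∨ t.HasActive P m a
  | a, lam t => t.HasActive P m a
  | a, lamT t => t.HasActive P m a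
  | a, pair t u => t.HasActive P m a ∨ u.HasActive P m a
  | a, fst t => t.HasActive P m a
  | a, snd t => t.HasActive P m a
  | a, inl t => t.HasActive P m a
  | a, inr t => t.HasActive P m a
  | a, case t u v => t.HasActive P m a ∨ u.HasActive P m a ∨ v.HasActive P m a
  | a, enc _ t => t.HasActive P m a
  | a, dest t u => t.HasActive P m a ∨ u.HasActive P m a
  | a, par u v => u.HasActive P m a ∨ v.HasActive P m a
  | a, em u v => u.HasActive P m (a + 1) ∨ v.HasActive P m (a + 1)
  | _, hyp _ _ => False
  | _, wit _ _ => False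
  | _, hyp0 _ => False

/-- Quasi-closedness under `i` binders of first-order variables, `j` binders of proof-term
variables and `k` binders of hypothesis variables. -/
def QuasiClosedAt : ℕ → ℕ → ℕ → PTerm L → Prop
  | _, j, _, var x => x < j
  | i, j, k, app t u => t.QuasiClosedAt i j k ∧ u.QuasiClosedAt i j k
  | i, j, k, appT t m => t.QuasiClosedAt i j k ∧ TermBelow i m
  | i, j, k, lam t => t.QuasiClosedAt i (j + 1) k
  | i, j, k, lamT t => t.QuasiClosedAt (i + 1) j k
  | i, j, k, pair t u => t.QuasiClosedAt i j k ∧ u.QuasiClosedAt i j k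
  | i, j, k, fst t => t.QuasiClosedAt i j k
  | i, j, k, snd t => t.QuasiClosedAt i j k
  | i, j, k, inl t => t.QuasiClosedAt i j k
  | i, j, k, inr t => t.QuasiClosedAt i j k
  | i, j, k, case t u v =>
      t.QuasiClosedAt i j k ∧ u.QuasiClosedAt i (j + 1) k ∧ v.QuasiClosedAt i (j + 1) k
  | i, j, k, enc m t => TermBelow i m ∧ t.QuasiClosedAt i j k
  | i, j, k, dest t u => t.QuasiClosedAt i j k ∧ u.QuasiClosedAt (i + 1) (j + 1) k
  | i, j, k, par u v => u.QuasiClosedAt i j k ∧ v.QuasiClosedAt i j k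
  | i, j, k, em u v => u.QuasiClosedAt i j (k + 1) ∧ v.QuasiClosedAt i j (k + 1)
  | i, _, k, hyp a A => (Formula.all A).Below i ∧ (k ≤ a → (Formula.all A).SimplyUniversal)
  | i, _, k, wit a P => (Formula.ex P).Below i ∧ a < k
  | i, _, _, hyp0 P => P.Below i

/-- Quasi-closed proof terms: no first-order variable and no proof-term variable is free (in
formulas that occur in the term, too), and every free occurrence of a hypothesis variable `a` is
in a subterm `H_a^{∀ α A}` with `∀ α A` simply universal. -/
def QuasiClosed (t : PTerm L) : Prop := t.QuasiClosedAt 0 0 0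

/-- One reduction step at the root. -/
inductive RootStep : PTerm L → PTerm L → Prop where
  | beta (u t : PTerm L) : RootStep (app (lam u) t) (u.instV t)
  | betaT (u : PTerm L) (m : L.Term ℕ) : RootStep (appT (lamT u) m) (u.instFO m)
  | fst (u v : PTerm L) : RootStep (fst (pair u v)) u
  | snd (u v : PTerm L) : RootStep (snd (pair u v)) v
  | caseL (u t₁ t₂ : PTerm L) : RootStep (case (inl u) t₁ t₂) (t₁.instV u)
  | caseR (u t₁ t₂ : PTerm L) : RootStep (case (inr u) t₁ t₂) (t₂.instV u)
  | dest (m : L.Term ℕ) (u v : PTerm L) :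
      RootStep (dest (enc m u) v) ((v.instFO m).instV u)
  | parApp (u v w : PTerm L) : RootStep (app (par u v) w) (par (app u w) (app v w))
  | parAppT (u v : PTerm L) (m : L.Term ℕ) :
      RootStep (appT (par u v) m) (par (appT u m) (appT v m))
  | parFst (u v : PTerm L) : RootStep (PTerm.fst (par u v)) (par (PTerm.fst u) (PTerm.fst v))
  | parSnd (u v : PTerm L) : RootStep (PTerm.snd (par u v)) (par (PTerm.snd u) (PTerm.snd v))
  | parCase (u v w₁ w₂ : PTerm L) :
      RootStep (case (par u v) w₁ w₂) (par (case u w₁ w₂) (case v w₁ w₂))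
  | parDest (u v w : PTerm L) :
      RootStep (PTerm.dest (par u v) w) (par (PTerm.dest u w) (PTerm.dest v w))
  /-- `u ∥ₐ v ↦ u` if `a` does not occur free in `u`; that `u` is a lifted term `u'` says so. -/
  | emDrop (u u' v : PTerm L) (h : u = u'.liftH) : RootStep (em u v) u'
  /-- `u ∥ₐ v ↦ v[a := m] ∥ (u[a := m] ∥ₐ v)` if `u` has an active subterm `H_a^{∀ α P} m`;
  both exception substitutions have to be defined. -/
  | emRaise (u v : PTerm L) (P : Formula L) (m : L.Term ℕ) (hact : u.HasActive P m 0)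
      (hu : u.OnlyHyp 0) (hv : v.OnlyWit 0) :
      RootStep (em u v) (par (v.catchWit 0 m) (em (u.raiseHyp 0 m) v))

/-- One reduction step `t ↦ t'` at any position, under binders too. -/
inductive Step : PTerm L → PTerm L → Prop where
  | root {t t' : PTerm L} (h : RootStep t t') : Step t t'
  | appL {t t' : PTerm L} (u : PTerm L) (h : Step t t') : Step (app t u) (app t' u)
  | appR (t : PTerm L) {u u' : PTerm L} (h : Step u u') : Step (app t u) (app t u')
  | appT {t t' : PTerm L} (m : L.Term ℕ) (h : Step t t') :
      Step (PTerm.appT t m) (PTerm.appT t' m)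
  | lam {t t' : PTerm L} (h : Step t t') : Step (PTerm.lam t) (PTerm.lam t')
  | lamT {t t' : PTerm L} (h : Step t t') : Step (PTerm.lamT t) (PTerm.lamT t')
  | pairL {t t' : PTerm L} (u : PTerm L) (h : Step t t') : Step (pair t u) (pair t' u)
  | pairR (t : PTerm L) {u u' : PTerm L} (h : Step u u') : Step (pair t u) (pair t u')
  | fst {t t' : PTerm L} (h : Step t t') : Step (PTerm.fst t) (PTerm.fst t')
  | snd {t t' : PTerm L} (h : Step t t') : Step (PTerm.snd t) (PTerm.snd t')
  | inl {t t' : PTerm L} (h : Step t t') : Step (PTerm.inl t) (PTerm.inl t')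
  | inr {t t' : PTerm L} (h : Step t t') : Step (PTerm.inr t) (PTerm.inr t')
  | case₀ {t t' : PTerm L} (u v : PTerm L) (h : Step t t') : Step (case t u v) (case t' u v)
  | case₁ (t : PTerm L) {u u' : PTerm L} (v : PTerm L) (h : Step u u') :
      Step (case t u v) (case t u' v)
  | case₂ (t u : PTerm L) {v v' : PTerm L} (h : Step v v') : Step (case t u v) (case t u v')
  | enc (m : L.Term ℕ) {t t' : PTerm L} (h : Step t t') :
      Step (PTerm.enc m t) (PTerm.enc m t')
  | destL {t t' : PTerm L} (u : PTerm L) (h : Step t t') : Step (dest t u) (dest t' u)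
  | destR (t : PTerm L) {u u' : PTerm L} (h : Step u u') : Step (dest t u) (dest t u')
  | parL {u u' : PTerm L} (v : PTerm L) (h : Step u u') : Step (par u v) (par u' v)
  | parR (u : PTerm L) {v v' : PTerm L} (h : Step v v') : Step (par u v) (par u v')
  | emL {u u' : PTerm L} (v : PTerm L) (h : Step u u') : Step (em u v) (em u' v)
  | emR (u : PTerm L) {v v' : PTerm L} (h : Step v v') : Step (em u v) (em u v')

/-- `t ↦* t'`. -/
def Reduces (t t' : PTerm L) : Prop := Relation.ReflTransGen Step t t'

/-- `t` is in normal form. -/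
def Normal (t : PTerm L) : Prop := ∀ t', ¬ Step t t'

/-- Herbrand normal forms. -/
inductive HerbrandNF : PTerm L → Prop where
  | enc (m : L.Term ℕ) (u : PTerm L) (h : Normal (enc m u)) : HerbrandNF (PTerm.enc m u)
  | par (u v : PTerm L) (hu : HerbrandNF u) (hv : HerbrandNF v) : HerbrandNF (PTerm.par u v)

/-- For a parallel composition of pairs `(m₀, u₀) ∥ … ∥ (mₖ, uₖ)`, bracketed in any way, the
list `m₀, …, mₖ`. -/
def witnesses : PTerm L → List (L.Term ℕ)
  | enc m _ => [m]
  | par u v => u.witnesses ++ v.witnesses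
  | _ => []

end PTerm

/-- Contexts. `vars` lists the types of the proof-term variables, `hyps` the types of the
hypothesis variables. The term `H^P` does not mention the hypothesis variable `a : P` that it
uses, and `a : P` with `P` propositional cannot be used in any other way; hence assumptions
`a : P` with `P` propositional are listed in `props`, without a variable. -/
structure Ctx (L : FirstOrder.Language.{u, v}) : Type (max u v) where
  vars : List (Formula L)
  hyps : List (Formula L)
  props : List (Formula L)

namespace Ctx

variable {L : FirstOrder.Language.{u, v}}

/-- `Γ, x : A` -/
def addVar (Γ : Ctx L) (A : Formula L) : Ctx L := { Γ with vars := A :: Γ.vars }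

/-- `Γ, a : A`, with `A` of the form `∀ α P` or `∃ α P` -/
def addHyp (Γ : Ctx L) (A : Formula L) : Ctx L := { Γ with hyps := A :: Γ.hyps }

/-- `Γ, a : P`, with `P` propositional -/
def addProp (Γ : Ctx L) (P : Formula L) : Ctx L := { Γ with props := P :: Γ.props }

/-- `Γ` read under one more first-order binder; the new variable is not free in it. -/
def lift (Γ : Ctx L) : Ctx L :=
  ⟨Γ.vars.map Formula.lift, Γ.hyps.map Formula.lift, Γ.props.map Formula.lift⟩

end Ctx

/-- `HasType Γ t A` is the judgement `Γ ⊢ t : A` of `IL + EM₁⁻`. -/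
inductive HasType {L : FirstOrder.Language.{u, v}} : Ctx L → PTerm L → Formula L → Prop where
  | var {Γ : Ctx L} {x : ℕ} {A : Formula L} (h : Γ.vars[x]? = some A) :
      HasType Γ (PTerm.var x) A
  | hyp {Γ : Ctx L} {a : ℕ} {A : Formula L} (h : Γ.hyps[a]? = some (Formula.all A))
      (hA : A.SimplyUniversal) : HasType Γ (PTerm.hyp a A) (Formula.all A)
  | wit {Γ : Ctx L} {a : ℕ} {P : Formula L} (h : Γ.hyps[a]? = some (Formula.ex P))
      (hP : P.Negative) : HasType Γ (PTerm.wit a P) (Formula.ex P)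
  | hyp0 {Γ : Ctx L} {P : Formula L} (h : P ∈ Γ.props) (hP : P.Negative) :
      HasType Γ (PTerm.hyp0 P) P
  | exfalso {Γ : Ctx L} {P : Formula L} (hP : P.Negative) :
      HasType Γ (PTerm.hyp0 (Formula.imp Formula.bot P)) (Formula.imp Formula.bot P)
  | pair {Γ : Ctx L} {u t : PTerm L} {A B : Formula L} (hu : HasType Γ u A)
      (ht : HasType Γ t B) : HasType Γ (PTerm.pair u t) (Formula.and A B)
  | fst {Γ : Ctx L} {u : PTerm L} {A B : Formula L} (hu : HasType Γ u (Formula.and A B)) :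
      HasType Γ (PTerm.fst u) A
  | snd {Γ : Ctx L} {u : PTerm L} {A B : Formula L} (hu : HasType Γ u (Formula.and A B)) :
      HasType Γ (PTerm.snd u) B
  | app {Γ : Ctx L} {t u : PTerm L} {A B : Formula L} (ht : HasType Γ t (Formula.imp A B))
      (hu : HasType Γ u A) : HasType Γ (PTerm.app t u) B
  | lam {Γ : Ctx L} {u : PTerm L} {A B : Formula L} (hu : HasType (Γ.addVar A) u B) :
      HasType Γ (PTerm.lam u) (Formula.imp A B)
  | inl {Γ : Ctx L} {u : PTerm L} {A B : Formula L} (hu : HasType Γ u A) :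
      HasType Γ (PTerm.inl u) (Formula.or A B)
  | inr {Γ : Ctx L} {u : PTerm L} {A B : Formula L} (hu : HasType Γ u B) :
      HasType Γ (PTerm.inr u) (Formula.or A B)
  | case {Γ : Ctx L} {u w₁ w₂ : PTerm L} {A B C : Formula L}
      (hu : HasType Γ u (Formula.or A B)) (h₁ : HasType (Γ.addVar A) w₁ C)
      (h₂ : HasType (Γ.addVar B) w₂ C) : HasType Γ (PTerm.case u w₁ w₂) C
  | appT {Γ : Ctx L} {u : PTerm L} {A : Formula L} (m : L.Term ℕ)
      (hu : HasType Γ u (Formula.all A)) : HasType Γ (PTerm.appT u m) (A.inst m)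
  | lamT {Γ : Ctx L} {u : PTerm L} {A : Formula L} (hu : HasType Γ.lift u A) :
      HasType Γ (PTerm.lamT u) (Formula.all A)
  | enc {Γ : Ctx L} {u : PTerm L} {A : Formula L} (m : L.Term ℕ)
      (hu : HasType Γ u (A.inst m)) : HasType Γ (PTerm.enc m u) (Formula.ex A)
  | dest {Γ : Ctx L} {u t : PTerm L} {A C : Formula L} (hu : HasType Γ u (Formula.ex A))
      (ht : HasType (Γ.lift.addVar A) t C.lift) : HasType Γ (PTerm.dest u t) C
  /-- the rule `EM₀` -/
  | em0 {Γ : Ctx L} {u v : PTerm L} {P C : Formula L} (hP : P.Negative)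
      (hu : HasType (Γ.addProp P.neg) u C) (hv : HasType (Γ.addProp P) v C) :
      HasType Γ (PTerm.par u v) C
  /-- the rule `EM₁⁻` -/
  | em1 {Γ : Ctx L} {u v : PTerm L} {P Q : Formula L} (hP : P.Negative) (hQ : Q.Negative)
      (hu : HasType (Γ.addHyp (Formula.all P)) u (Formula.ex Q))
      (hv : HasType (Γ.addHyp (Formula.ex P.neg)) v (Formula.ex Q)) :
      HasType Γ (PTerm.em u v) (Formula.ex Q)

end ILEM

end

/-! Reduction preserves typing (`HasType.step`) and quasi-closedness (`PTerm.QuasiClosedAt.step`),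
so everything rests on the shape of a typed, quasi-closed, normal term. No termination argument is
needed, because the normal form is given.

Subject reduction is delicate only for the classical rule. When `u ∥ₐ v` raises the active instance
`m`, the reduct `v[a:=m] ∥ (u[a:=m] ∥ₐ v)` is an instance of EM₀ for the negative formula `P[m/α]`.
On the left, `¬P[m/α]` justifies the pair that replaces the witness term. On the right, `P[m/α]`
justifies the constant that replaces `H_a m`. Quasi-closedness survives because an active `m` is
closed, so it can leave the binders under which it was found.

The core is `PTerm.normal_shape`: no quasi-closed normal term is of the form `u ∥ₐ v`. The
conclusion of EM₁⁻ is `∃β Q` with `Q` negative. In a normal `u` of such a type, every head of an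
elimination is neutral of simply universal type, so neither case distinction nor existential
elimination occurs. In the relevant positions no quantifier is opened, hence first-order terms there
are closed. An occurrence of `H_a` cannot stand alone in a negative type, so it is applied to a
closed term and is active. Therefore either `a` is active in `u` and can be raised, or it is absent
from `u` and `v` can be dropped: `u ∥ₐ v` reduces in both cases (`PTerm.not_normal_em`).

A normal proof of `∃α A` is then a pair or a parallel composition, since a neutral term has simply
universal type (`PTerm.herbrandNF_of_normal`). The disjunction is proved by keeping the tree of EM₀
inferences and replacing each leaf `(m, u)` by the injections of `u`
(`PTerm.HerbrandNF.exists_disj`). -/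

namespace ILEM

open FirstOrder.Language (Term)

/-! ### Substitution calculus and bounds on free variables for first-order terms and formulas. -/

section FirstOrderSyntax

variable {L : FirstOrder.Language.{u, v}}

theorem term_subst_subst (t : L.Term ℕ) (σ τ : ℕ → L.Term ℕ) :
    (t.subst σ).subst τ = t.subst (fun n => (σ n).subst τ) := by
  induction t with
  | var n => rfl
  | func f ts ih => simp only [Term.subst, ih]

theorem liftTerm_eq_subst (t : L.Term ℕ) : liftTerm t = t.subst shiftT := by
  induction t with
  | var n => rfl
  | func f ts ih =>
    simp only [liftTerm, Term.relabel, Term.subst] at ih ⊢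
    simp only [ih]

theorem term_subst_var (t : L.Term ℕ) : t.subst Term.var = t := by
  induction t with
  | var n => rfl
  | func f ts ih => simp only [Term.subst, ih]

theorem liftTerm_subst (t : L.Term ℕ) (τ : ℕ → L.Term ℕ) :
    (liftTerm t).subst τ = t.subst (fun n => τ (n + 1)) := by
  rw [liftTerm_eq_subst, term_subst_subst]; rfl

theorem liftTerm_subst_upT (t : L.Term ℕ) (τ : ℕ → L.Term ℕ) :
    (liftTerm t).subst (upT τ) = liftTerm (t.subst τ) := by
  rw [liftTerm_subst, liftTerm_eq_subst, term_subst_subst]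
  simp only [upT, liftTerm_eq_subst]

theorem upT_comp (σ τ : ℕ → L.Term ℕ) :
    (fun n => (upT σ n).subst (upT τ)) = upT (fun n => (σ n).subst τ) := by
  funext n
  cases n with
  | zero => rfl
  | succ n => exact liftTerm_subst_upT _ _

theorem upT_var : upT (Term.var : ℕ → L.Term ℕ) = Term.var := by
  funext n
  cases n <;> rfl

@[simp] theorem termBelow_var (k i : ℕ) : TermBelow k (Term.var i : L.Term ℕ) ↔ i < k := by
  simp [TermBelow, Term.varFinset]

@[simp] theorem termBelow_func (k : ℕ) {n : ℕ} (f : L.Functions n) (ts : Fin n → L.Term ℕ) :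
    TermBelow k (Term.func f ts) ↔ ∀ i, TermBelow k (ts i) := by
  simp only [TermBelow, Term.varFinset, Finset.mem_biUnion, Finset.mem_univ, true_and]
  exact ⟨fun h i j hj => h j ⟨i, hj⟩, fun h j ⟨i, hj⟩ => h i j hj⟩

theorem TermBelow.mono {k l : ℕ} {t : L.Term ℕ} (h : TermBelow k t) (hkl : k ≤ l) :
    TermBelow l t := fun i hi => (h i hi).trans_le hkl

theorem TermBelow.subst {k l : ℕ} {t : L.Term ℕ} {σ : ℕ → L.Term ℕ} (h : TermBelow k t)
    (hσ : ∀ n < k, TermBelow l (σ n)) : TermBelow l (t.subst σ) := by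
  induction t with
  | var n => exact hσ n (by simpa using h)
  | func f ts ih =>
    simp only [Term.subst, termBelow_func] at h ⊢
    exact fun i => ih i (h i)

theorem termBelow_liftTerm {k : ℕ} {t : L.Term ℕ} :
    TermBelow (k + 1) (liftTerm t) ↔ TermBelow k t := by
  induction t with
  | var n => simp [liftTerm, Term.relabel]
  | func f ts ih =>
    simp only [liftTerm, Term.relabel, termBelow_func] at ih ⊢
    simp only [ih]

theorem termBelow_upT {k l : ℕ} {σ : ℕ → L.Term ℕ} (hσ : ∀ n < k, TermBelow l (σ n)) :
    ∀ n < k + 1, TermBelow (l + 1) (upT σ n)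
  | 0, _ => by simp [upT]
  | n + 1, h => termBelow_liftTerm.2 (hσ n (by omega))

theorem termBelow_shiftT (k : ℕ) : ∀ n < k, TermBelow (k + 1) (shiftT n : L.Term ℕ) :=
  fun n h => by simpa [shiftT] using h

theorem termBelow_instT {k : ℕ} {m : L.Term ℕ} (hm : TermBelow k m) :
    ∀ n < k + 1, TermBelow k (instT m n)
  | 0, _ => hm
  | n + 1, h => by simpa [instT] using h

/-- By `hσ`, a variable that `σ` moves goes to a term violating the bound `k`. A bounded result
therefore contains no trace of a moved variable. -/
theorem term_subst_eq_self {k : ℕ} {σ : ℕ → L.Term ℕ}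
    (hσ : ∀ n, TermBelow k (σ n) → σ n = Term.var n) {t : L.Term ℕ}
    (h : TermBelow k (t.subst σ)) : t.subst σ = t := by
  induction t with
  | var n => exact hσ n h
  | func f ts ih =>
    simp only [Term.subst, termBelow_func] at h ⊢
    congr 1
    funext i
    exact ih i (h i)

namespace Formula

theorem subst_subst (A : Formula L) (σ τ : ℕ → L.Term ℕ) :
    (A.subst σ).subst τ = A.subst (fun n => (σ n).subst τ) := by
  induction A generalizing σ τ with
  | bot => rfl
  | rel R ts => simp only [subst, term_subst_subst]
  | and A B ihA ihB => simp only [subst, ihA, ihB]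
  | or A B ihA ihB => simp only [subst, ihA, ihB]
  | imp A B ihA ihB => simp only [subst, ihA, ihB]
  | all A ih => simp only [subst, ih, upT_comp]
  | ex A ih => simp only [subst, ih, upT_comp]

theorem subst_var (A : Formula L) : A.subst Term.var = A := by
  induction A with
  | bot => rfl
  | rel R ts => simp only [subst, term_subst_var]
  | and A B ihA ihB => simp only [subst, ihA, ihB]
  | or A B ihA ihB => simp only [subst, ihA, ihB]
  | imp A B ihA ihB => simp only [subst, ihA, ihB]
  | all A ih => simp only [subst, upT_var, ih]
  | ex A ih => simp only [subst, upT_var, ih]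

theorem inst_subst (A : Formula L) (m : L.Term ℕ) (σ : ℕ → L.Term ℕ) :
    (A.inst m).subst σ = (A.subst (upT σ)).inst (m.subst σ) := by
  simp only [inst, subst_subst]
  congr 1
  funext n
  cases n with
  | zero => rfl
  | succ n =>
    simp only [upT, liftTerm_subst, instT]
    exact (term_subst_var _).symm

theorem lift_subst (A : Formula L) (σ : ℕ → L.Term ℕ) :
    A.lift.subst (upT σ) = (A.subst σ).lift := by
  simp only [lift, subst_subst]
  congr 1
  funext n
  exact liftTerm_eq_subst _

theorem lift_inst (A : Formula L) (m : L.Term ℕ) : A.lift.inst m = A := by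
  simp only [lift, inst, subst_subst]
  exact A.subst_var

theorem lift_all (A : Formula L) : (all A).lift = all (A.subst (upT shiftT)) := rfl

theorem lift_ex (A : Formula L) : (ex A).lift = ex (A.subst (upT shiftT)) := rfl

theorem inst_lift (A : Formula L) (m : L.Term ℕ) :
    (A.inst m).lift = (A.subst (upT shiftT)).inst (liftTerm m) := by
  rw [lift, inst_subst, liftTerm_eq_subst]

theorem Negative.subst {A : Formula L} (h : A.Negative) (σ : ℕ → L.Term ℕ) :
    (A.subst σ).Negative := by
  induction A with
  | bot => trivial
  | rel R ts => trivial
  | and A B ihA ihB => exact ⟨ihA h.1, ihB h.2⟩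
  | or A B => exact h
  | imp A B ihA ihB => exact ⟨ihA h.1, ihB h.2⟩
  | all A => exact h
  | ex A => exact h

theorem Negative.simplyUniversal {A : Formula L} (h : A.Negative) : A.SimplyUniversal := by
  cases A <;> first | exact h | exact h.elim

theorem SimplyUniversal.subst {A : Formula L} (h : A.SimplyUniversal) (σ : ℕ → L.Term ℕ) :
    (A.subst σ).SimplyUniversal := by
  induction A generalizing σ with
  | all A ih => exact ih h _
  | bot => trivial
  | rel R ts => trivial
  | and A B => exact Negative.subst (A := and A B) h σ
  | or A B => exact Negative.subst (A := or A B) h σ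
  | imp A B => exact Negative.subst (A := imp A B) h σ
  | ex A => exact Negative.subst (A := ex A) h σ

theorem Below.subst {k l : ℕ} {A : Formula L} {σ : ℕ → L.Term ℕ} (h : A.Below k)
    (hσ : ∀ n < k, TermBelow l (σ n)) : (A.subst σ).Below l := by
  induction A generalizing k l σ with
  | bot => trivial
  | rel R ts => exact fun i => (h i).subst hσ
  | and A B ihA ihB => exact ⟨ihA h.1 hσ, ihB h.2 hσ⟩
  | or A B ihA ihB => exact ⟨ihA h.1 hσ, ihB h.2 hσ⟩
  | imp A B ihA ihB => exact ⟨ihA h.1 hσ, ihB h.2 hσ⟩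
  | all A ih => exact ih (k := k + 1) (l := l + 1) h (termBelow_upT hσ)
  | ex A ih => exact ih (k := k + 1) (l := l + 1) h (termBelow_upT hσ)

theorem subst_eq_self {k : ℕ} {A : Formula L} {σ : ℕ → L.Term ℕ}
    (hσ : ∀ n, TermBelow k (σ n) → σ n = Term.var n) (h : (A.subst σ).Below k) :
    A.subst σ = A := by
  have up : ∀ {k : ℕ} {σ : ℕ → L.Term ℕ}, (∀ n, TermBelow k (σ n) → σ n = Term.var n) →
      ∀ n, TermBelow (k + 1) (upT σ n) → upT σ n = Term.var n := by
    intro k σ hσ n hn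
    cases n with
    | zero => rfl
    | succ n =>
      simp only [upT] at hn ⊢
      rw [hσ n (termBelow_liftTerm.1 hn)]
      rfl
  induction A generalizing k σ with
  | bot => rfl
  | rel R ts =>
    simp only [subst]
    congr 1
    funext i
    exact term_subst_eq_self hσ (h i)
  | and A B ihA ihB => exact congrArg₂ and (ihA hσ h.1) (ihB hσ h.2)
  | or A B ihA ihB => exact congrArg₂ or (ihA hσ h.1) (ihB hσ h.2)
  | imp A B ihA ihB => exact congrArg₂ imp (ihA hσ h.1) (ihB hσ h.2)
  | all A ih => exact congrArg all (ih (up hσ) h)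
  | ex A ih => exact congrArg ex (ih (up hσ) h)

/-- Index `0` is fixed and index `n + 1` goes to `n + 2`, which is never below `1`. This undoes the
lifting of a hypothesis `∀α R` when an active subterm sits under first-order binders. -/
theorem subst_upT_shiftT_eq_self {A : Formula L} (h : (A.subst (upT shiftT)).Below 1) :
    A.subst (upT shiftT) = A := by
  refine subst_eq_self (fun n hn => ?_) h
  cases n with
  | zero => rfl
  | succ n => simp [upT, shiftT, liftTerm, Term.relabel] at hn

end Formula

end FirstOrderSyntax

/-! ### Structural properties of typing and subject reduction. -/

section Typing

variable {L : FirstOrder.Language.{u, v}}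

namespace Ctx

/-- First-order substitution in all assumptions of a context. -/
def subst (σ : ℕ → L.Term ℕ) (Γ : Ctx L) : Ctx L :=
  ⟨Γ.vars.map (Formula.subst σ), Γ.hyps.map (Formula.subst σ), Γ.props.map (Formula.subst σ)⟩

theorem lift_subst (Γ : Ctx L) (σ : ℕ → L.Term ℕ) :
    Γ.lift.subst (upT σ) = (Γ.subst σ).lift := by
  simp [lift, subst, Function.comp_def, Formula.lift_subst]

theorem lift_subst_instT (Γ : Ctx L) (m : L.Term ℕ) : Γ.lift.subst (instT m) = Γ := by
  have h : ∀ A : Formula L, A.lift.subst (instT m) = A := fun A => A.lift_inst m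
  simp [lift, subst, Function.comp_def, h]

end Ctx

namespace HasType

/-- The quantifier rules are stable because `inst` and `lift`, on formulas and on contexts, commute
with substitution, and because negativity and simple universality are substitution invariant. -/
theorem substT {Γ : Ctx L} {t : PTerm L} {A : Formula L} (h : HasType Γ t A)
    (σ : ℕ → L.Term ℕ) : HasType (Γ.subst σ) (t.substT σ) (A.subst σ) := by
  induction h generalizing σ with
  | var h => exact .var (by simp [Ctx.subst, h])
  | hyp h hA => exact .hyp (by simp [Ctx.subst, h, Formula.subst]) (hA.subst _)
  | wit h hP => exact .wit (by simp [Ctx.subst, h, Formula.subst]) (hP.subst _)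
  | hyp0 h hP => exact .hyp0 (List.mem_map_of_mem h) (hP.subst _)
  | exfalso hP => exact .exfalso (hP.subst _)
  | pair _ _ ih₁ ih₂ => exact .pair (ih₁ σ) (ih₂ σ)
  | fst _ ih => exact .fst (ih σ)
  | snd _ ih => exact .snd (ih σ)
  | app _ _ ih₁ ih₂ => exact .app (ih₁ σ) (ih₂ σ)
  | lam _ ih => exact .lam (ih σ)
  | inl _ ih => exact .inl (ih σ)
  | inr _ ih => exact .inr (ih σ)
  | case _ _ _ ih ih₁ ih₂ => exact .case (ih σ) (ih₁ σ) (ih₂ σ)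
  | appT m _ ih => rw [Formula.inst_subst]; exact .appT _ (ih σ)
  | lamT _ ih => exact .lamT (by rw [← Ctx.lift_subst]; exact ih _)
  | enc m _ ih => exact .enc _ (by rw [← Formula.inst_subst]; exact ih σ)
  | @dest Γ u t A C _ _ ih₁ ih₂ =>
    refine .dest (ih₁ σ) ?_
    have := ih₂ (upT σ)
    rw [Formula.lift_subst] at this
    rw [← Ctx.lift_subst]
    exact this
  | em0 hP _ _ ih₁ ih₂ => exact .em0 (hP.subst σ) (ih₁ σ) (ih₂ σ)
  | em1 hP hQ _ _ ih₁ ih₂ => exact .em1 (hP.subst _) (hQ.subst _) (ih₁ σ) (ih₂ σ)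

theorem liftT {Γ : Ctx L} {t : PTerm L} {A : Formula L} (h : HasType Γ t A) :
    HasType Γ.lift t.liftT A.lift := h.substT shiftT

/-- Enlarging the list of propositional assumptions. -/
theorem weaken_props {Γ : Ctx L} {t : PTerm L} {A : Formula L} (h : HasType Γ t A)
    (l : List (Formula L)) (hl : Γ.props ⊆ l) : HasType { Γ with props := l } t A := by
  induction h generalizing l with
  | var h => exact .var h
  | hyp h hA => exact .hyp h hA
  | wit h hP => exact .wit h hP
  | hyp0 h hP => exact .hyp0 (hl h) hP
  | exfalso hP => exact .exfalso hP
  | pair _ _ ih₁ ih₂ => exact .pair (ih₁ l hl) (ih₂ l hl)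
  | fst _ ih => exact .fst (ih l hl)
  | snd _ ih => exact .snd (ih l hl)
  | app _ _ ih₁ ih₂ => exact .app (ih₁ l hl) (ih₂ l hl)
  | lam _ ih => exact .lam (ih l hl)
  | inl _ ih => exact .inl (ih l hl)
  | inr _ ih => exact .inr (ih l hl)
  | case _ _ _ ih ih₁ ih₂ => exact .case (ih l hl) (ih₁ l hl) (ih₂ l hl)
  | appT m _ ih => exact .appT m (ih l hl)
  | lamT _ ih => exact .lamT (ih _ (List.map_subset _ hl))
  | enc m _ ih => exact .enc m (ih l hl)
  | dest _ _ ih₁ ih₂ => exact .dest (ih₁ l hl) (ih₂ _ (List.map_subset _ hl))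
  | em0 hP _ _ ih₁ ih₂ =>
    exact .em0 hP (ih₁ _ (List.cons_subset_cons _ hl)) (ih₂ _ (List.cons_subset_cons _ hl))
  | em1 hP hQ _ _ ih₁ ih₂ => exact .em1 hP hQ (ih₁ l hl) (ih₂ l hl)

theorem addProp {Γ : Ctx L} {t : PTerm L} {A : Formula L} (h : HasType Γ t A) (P : Formula L) :
    HasType (Γ.addProp P) t A :=
  h.weaken_props _ (List.subset_cons_self _ _)

end HasType

/-! ### Renaming, strengthening and substitution of proof-term and hypothesis variables. -/

theorem getElem?_map_of_forall {f : Formula L → Formula L} {l l' : List (Formula L)} {ρ : ℕ → ℕ}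
    (h : ∀ (x : ℕ) B, l[x]? = some B → l'[ρ x]? = some B) (x : ℕ) (B : Formula L)
    (hx : (l.map f)[x]? = some B) : (l'.map f)[ρ x]? = some B := by
  rw [List.getElem?_map, Option.map_eq_some_iff] at hx ⊢
  obtain ⟨C, hC, rfl⟩ := hx
  exact ⟨C, h x C hC, rfl⟩

theorem getElem?_cons_of_forall {l l' : List (Formula L)} {ρ : ℕ → ℕ} (A : Formula L)
    (h : ∀ (x : ℕ) B, l[x]? = some B → l'[ρ x]? = some B) (x : ℕ) (B : Formula L)
    (hx : (A :: l)[x]? = some B) : (A :: l')[PTerm.upR ρ x]? = some B := by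
  cases x with
  | zero => exact hx
  | succ x => exact h x B hx

namespace HasType

theorem renV {Γ : Ctx L} {t : PTerm L} {A : Formula L} (h : HasType Γ t A) (ρ : ℕ → ℕ)
    (l : List (Formula L)) (hl : ∀ (x : ℕ) B, Γ.vars[x]? = some B → l[ρ x]? = some B) :
    HasType { Γ with vars := l } (t.renV ρ) A := by
  induction h generalizing ρ l with
  | var h => exact .var (hl _ _ h)
  | hyp h hA => exact .hyp h hA
  | wit h hP => exact .wit h hP
  | hyp0 h hP => exact .hyp0 h hP
  | exfalso hP => exact .exfalso hP
  | pair _ _ ih₁ ih₂ => exact .pair (ih₁ ρ l hl) (ih₂ ρ l hl)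
  | fst _ ih => exact .fst (ih ρ l hl)
  | snd _ ih => exact .snd (ih ρ l hl)
  | app _ _ ih₁ ih₂ => exact .app (ih₁ ρ l hl) (ih₂ ρ l hl)
  | lam _ ih => exact .lam (ih _ _ (getElem?_cons_of_forall _ hl))
  | inl _ ih => exact .inl (ih ρ l hl)
  | inr _ ih => exact .inr (ih ρ l hl)
  | case _ _ _ ih ih₁ ih₂ =>
    exact .case (ih ρ l hl) (ih₁ _ _ (getElem?_cons_of_forall _ hl))
      (ih₂ _ _ (getElem?_cons_of_forall _ hl))
  | appT m _ ih => exact .appT m (ih ρ l hl)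
  | lamT _ ih => exact .lamT (ih ρ _ (getElem?_map_of_forall hl))
  | enc m _ ih => exact .enc m (ih ρ l hl)
  | dest _ _ ih₁ ih₂ =>
    exact .dest (ih₁ ρ l hl) (ih₂ _ _ (getElem?_cons_of_forall _ (getElem?_map_of_forall hl)))
  | em0 hP _ _ ih₁ ih₂ => exact .em0 hP (ih₁ ρ l hl) (ih₂ ρ l hl)
  | em1 hP hQ _ _ ih₁ ih₂ => exact .em1 hP hQ (ih₁ ρ l hl) (ih₂ ρ l hl)

theorem liftV {Γ : Ctx L} {t : PTerm L} {A : Formula L} (h : HasType Γ t A) (B : Formula L) :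
    HasType (Γ.addVar B) t.liftV A :=
  h.renV Nat.succ _ (fun _ _ hx => hx)

theorem renH {Γ : Ctx L} {t : PTerm L} {A : Formula L} (h : HasType Γ t A) (ρ : ℕ → ℕ)
    (l : List (Formula L)) (hl : ∀ (x : ℕ) B, Γ.hyps[x]? = some B → l[ρ x]? = some B) :
    HasType { Γ with hyps := l } (t.renH ρ) A := by
  induction h generalizing ρ l with
  | var h => exact .var h
  | hyp h hA => exact .hyp (hl _ _ h) hA
  | wit h hP => exact .wit (hl _ _ h) hP
  | hyp0 h hP => exact .hyp0 h hP
  | exfalso hP => exact .exfalso hP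
  | pair _ _ ih₁ ih₂ => exact .pair (ih₁ ρ l hl) (ih₂ ρ l hl)
  | fst _ ih => exact .fst (ih ρ l hl)
  | snd _ ih => exact .snd (ih ρ l hl)
  | app _ _ ih₁ ih₂ => exact .app (ih₁ ρ l hl) (ih₂ ρ l hl)
  | lam _ ih => exact .lam (ih ρ l hl)
  | inl _ ih => exact .inl (ih ρ l hl)
  | inr _ ih => exact .inr (ih ρ l hl)
  | case _ _ _ ih ih₁ ih₂ => exact .case (ih ρ l hl) (ih₁ ρ l hl) (ih₂ ρ l hl)
  | appT m _ ih => exact .appT m (ih ρ l hl)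
  | lamT _ ih => exact .lamT (ih ρ _ (getElem?_map_of_forall hl))
  | enc m _ ih => exact .enc m (ih ρ l hl)
  | dest _ _ ih₁ ih₂ => exact .dest (ih₁ ρ l hl) (ih₂ ρ _ (getElem?_map_of_forall hl))
  | em0 hP _ _ ih₁ ih₂ => exact .em0 hP (ih₁ ρ l hl) (ih₂ ρ l hl)
  | em1 hP hQ _ _ ih₁ ih₂ =>
    exact .em1 hP hQ (ih₁ _ _ (getElem?_cons_of_forall _ hl))
      (ih₂ _ _ (getElem?_cons_of_forall _ hl))

theorem liftH {Γ : Ctx L} {t : PTerm L} {A : Formula L} (h : HasType Γ t A) (B : Formula L) :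
    HasType (Γ.addHyp B) t.liftH A :=
  h.renH Nat.succ _ (fun _ _ hx => hx)

/-- Strengthening: hypothesis variables outside the range of a renaming can be dropped. -/
theorem of_renH {Γ : Ctx L} {t : PTerm L} {A : Formula L} {ρ : ℕ → ℕ}
    (h : HasType Γ (t.renH ρ) A) (l : List (Formula L))
    (hl : ∀ (x : ℕ) B, Γ.hyps[ρ x]? = some B → l[x]? = some B) :
    HasType { Γ with hyps := l } t A := by
  have hmap : ∀ {l₁ l₂ : List (Formula L)} {ρ : ℕ → ℕ} (f : Formula L → Formula L),
      (∀ (x : ℕ) B, l₁[ρ x]? = some B → l₂[x]? = some B) →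
      ∀ (x : ℕ) B, (l₁.map f)[ρ x]? = some B → (l₂.map f)[x]? = some B := by
    intro l₁ l₂ ρ f h x B hx
    rw [List.getElem?_map, Option.map_eq_some_iff] at hx ⊢
    obtain ⟨C, hC, rfl⟩ := hx
    exact ⟨C, h x C hC, rfl⟩
  have hcons : ∀ {l₁ l₂ : List (Formula L)} {ρ : ℕ → ℕ} (A : Formula L),
      (∀ (x : ℕ) B, l₁[ρ x]? = some B → l₂[x]? = some B) →
      ∀ (x : ℕ) B, (A :: l₁)[PTerm.upR ρ x]? = some B → (A :: l₂)[x]? = some B := by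
    intro l₁ l₂ ρ A h x B hx
    cases x with
    | zero => exact hx
    | succ x => exact h x B hx
  -- The derivation types `t.renH ρ`, so the induction runs over `t` and inverts the derivation at
  -- each constructor.
  induction t generalizing Γ A ρ l with
  | var x => cases h with | var h => exact .var h
  | app t u ih₁ ih₂ => cases h with | app h₁ h₂ => exact .app (ih₁ h₁ l hl) (ih₂ h₂ l hl)
  | appT t m ih => cases h with | appT _ h => exact .appT m (ih h l hl)
  | lam t ih => cases h with | lam h => exact .lam (ih h l hl)
  | lamT t ih => cases h with | lamT h => exact .lamT (ih h _ (hmap _ hl))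
  | pair t u ih₁ ih₂ => cases h with | pair h₁ h₂ => exact .pair (ih₁ h₁ l hl) (ih₂ h₂ l hl)
  | fst t ih => cases h with | fst h => exact .fst (ih h l hl)
  | snd t ih => cases h with | snd h => exact .snd (ih h l hl)
  | inl t ih => cases h with | inl h => exact .inl (ih h l hl)
  | inr t ih => cases h with | inr h => exact .inr (ih h l hl)
  | case t u v ih ih₁ ih₂ =>
    cases h with | case h h₁ h₂ => exact .case (ih h l hl) (ih₁ h₁ l hl) (ih₂ h₂ l hl)
  | enc m t ih => cases h with | enc _ h => exact .enc m (ih h l hl)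
  | dest t u ih₁ ih₂ =>
    cases h with | dest h₁ h₂ => exact .dest (ih₁ h₁ l hl) (ih₂ h₂ _ (hmap _ hl))
  | par u v ih₁ ih₂ => cases h with | em0 hP h₁ h₂ => exact .em0 hP (ih₁ h₁ l hl) (ih₂ h₂ l hl)
  | em u v ih₁ ih₂ =>
    cases h with
    | em1 hP hQ h₁ h₂ => exact .em1 hP hQ (ih₁ h₁ _ (hcons _ hl)) (ih₂ h₂ _ (hcons _ hl))
  | hyp a B => cases h with | hyp h hA => exact .hyp (hl _ _ h) hA
  | wit a P => cases h with | wit h hP => exact .wit (hl _ _ h) hP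
  | hyp0 P =>
    cases h with
    | hyp0 h hP => exact .hyp0 h hP
    | exfalso hP => exact .exfalso hP

theorem of_liftH {Γ : Ctx L} {t : PTerm L} {A B : Formula L}
    (h : HasType (Γ.addHyp B) t.liftH A) : HasType Γ t A :=
  h.of_renH Γ.hyps (fun _ _ hx => hx)

/-- Only the list of proof-term variables changes. Each binder crossed asks for the matching
weakening of the images of `τ`: `liftV`, `liftT`, `liftH`, or `addProp` for the nameless assumptions
of EM₀. -/
theorem substV {Γ : Ctx L} {t : PTerm L} {A : Formula L} (h : HasType Γ t A) (τ : ℕ → PTerm L)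
    (l : List (Formula L))
    (hl : ∀ (x : ℕ) B, Γ.vars[x]? = some B → HasType { Γ with vars := l } (τ x) B) :
    HasType { Γ with vars := l } (t.substV τ) A := by
  have up : ∀ {Γ : Ctx L} {l : List (Formula L)} {τ : ℕ → PTerm L} (C : Formula L),
      (∀ (x : ℕ) B, Γ.vars[x]? = some B → HasType { Γ with vars := l } (τ x) B) →
      ∀ (x : ℕ) B, (Γ.addVar C).vars[x]? = some B →
        HasType { Γ with vars := C :: l } (PTerm.upV τ x) B := by
    intro Γ l τ C h x B hx
    cases x with
    | zero => exact .var hx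
    | succ x => exact (h x B hx).liftV C
  have lft : ∀ {Γ : Ctx L} {l : List (Formula L)} {τ : ℕ → PTerm L},
      (∀ (x : ℕ) B, Γ.vars[x]? = some B → HasType { Γ with vars := l } (τ x) B) →
      ∀ (x : ℕ) B, Γ.lift.vars[x]? = some B →
        HasType { Γ.lift with vars := l.map Formula.lift } (τ x).liftT B := by
    intro Γ l τ h x B hx
    simp only [Ctx.lift, List.getElem?_map, Option.map_eq_some_iff] at hx
    obtain ⟨C, hC, rfl⟩ := hx
    exact (h x C hC).liftT
  induction h generalizing τ l with
  | var h => exact hl _ _ h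
  | hyp h hA => exact .hyp h hA
  | wit h hP => exact .wit h hP
  | hyp0 h hP => exact .hyp0 h hP
  | exfalso hP => exact .exfalso hP
  | pair _ _ ih₁ ih₂ => exact .pair (ih₁ τ l hl) (ih₂ τ l hl)
  | fst _ ih => exact .fst (ih τ l hl)
  | snd _ ih => exact .snd (ih τ l hl)
  | app _ _ ih₁ ih₂ => exact .app (ih₁ τ l hl) (ih₂ τ l hl)
  | lam _ ih => exact .lam (ih _ _ (up _ hl))
  | inl _ ih => exact .inl (ih τ l hl)
  | inr _ ih => exact .inr (ih τ l hl)
  | case _ _ _ ih ih₁ ih₂ => exact .case (ih τ l hl) (ih₁ _ _ (up _ hl)) (ih₂ _ _ (up _ hl))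
  | appT m _ ih => exact .appT m (ih τ l hl)
  | lamT _ ih => exact .lamT (ih _ _ (lft hl))
  | enc m _ ih => exact .enc m (ih τ l hl)
  | dest _ _ ih₁ ih₂ => exact .dest (ih₁ τ l hl) (ih₂ _ _ (up _ (lft hl)))
  | em0 hP _ _ ih₁ ih₂ =>
    exact .em0 hP (ih₁ τ l fun x B hx => (hl x B hx).addProp _)
      (ih₂ τ l fun x B hx => (hl x B hx).addProp _)
  | em1 hP hQ _ _ ih₁ ih₂ =>
    exact .em1 hP hQ (ih₁ _ l fun x B hx => (hl x B hx).liftH _)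
      (ih₂ _ l fun x B hx => (hl x B hx).liftH _)

theorem instV {Γ : Ctx L} {u t : PTerm L} {A B : Formula L} (hu : HasType (Γ.addVar A) u B)
    (ht : HasType Γ t A) : HasType Γ (u.instV t) B := by
  refine hu.substV _ Γ.vars fun x C hx => ?_
  cases x with
  | zero =>
    obtain rfl : A = C := by simpa [Ctx.addVar] using hx
    exact ht
  | succ x => exact .var hx

theorem instFO {Γ : Ctx L} {u : PTerm L} {A : Formula L} (hu : HasType Γ.lift u A)
    (m : L.Term ℕ) : HasType Γ (u.instFO m) (A.inst m) := by
  have := hu.substT (instT m)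
  rwa [Ctx.lift_subst_instT] at this

/-- The assumption `a : ∃α R` is traded for the propositional assumption `R[m/α]`. The list `l` is
the hypothesis list without entry `a`, described by where the remaining indices go. -/
theorem catchWit {Γ : Ctx L} {t : PTerm L} {A : Formula L} (h : HasType Γ t A) {a : ℕ}
    {R : Formula L} {m : L.Term ℕ} (l : List (Formula L)) (ha : Γ.hyps[a]? = some (Formula.ex R))
    (hl : ∀ (b : ℕ) B, b ≠ a → Γ.hyps[b]? = some B → l[PTerm.dropIdx a b]? = some B)
    (hR : R.inst m ∈ Γ.props) : HasType { Γ with hyps := l } (t.catchWit a m) A := by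
  have hcons : ∀ {l₁ l₂ : List (Formula L)} {a : ℕ} (C : Formula L),
      (∀ (b : ℕ) B, b ≠ a → l₁[b]? = some B → l₂[PTerm.dropIdx a b]? = some B) →
      ∀ (b : ℕ) B, b ≠ a + 1 → (C :: l₁)[b]? = some B →
        (C :: l₂)[PTerm.dropIdx (a + 1) b]? = some B := by
    intro l₁ l₂ a C h b B hb hB
    cases b with
    | zero => simpa [PTerm.dropIdx] using hB
    | succ b =>
      have e : PTerm.dropIdx (a + 1) (b + 1) = PTerm.dropIdx a b + 1 := by
        simp only [PTerm.dropIdx]; split_ifs <;> omega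
      rw [e]
      exact h b B (by omega) hB
  have hmap : ∀ {l₁ l₂ : List (Formula L)} {a : ℕ} (f : Formula L → Formula L),
      (∀ (b : ℕ) B, b ≠ a → l₁[b]? = some B → l₂[PTerm.dropIdx a b]? = some B) →
      ∀ (b : ℕ) B, b ≠ a → (l₁.map f)[b]? = some B →
        (l₂.map f)[PTerm.dropIdx a b]? = some B := by
    intro l₁ l₂ a f h b B hb hx
    rw [List.getElem?_map, Option.map_eq_some_iff] at hx ⊢
    obtain ⟨C, hC, rfl⟩ := hx
    exact ⟨C, h b C hb hC, rfl⟩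
  have hlift : ∀ {Γ : Ctx L} {a : ℕ} {R : Formula L}, Γ.hyps[a]? = some (Formula.ex R) →
      Γ.lift.hyps[a]? = some (Formula.ex (R.subst (upT shiftT))) := by
    intro Γ a R h
    simp [Ctx.lift, h, Formula.lift_ex]
  have hprop : ∀ {Γ : Ctx L} {R : Formula L} {m : L.Term ℕ}, R.inst m ∈ Γ.props →
      (R.subst (upT shiftT)).inst (liftTerm m) ∈ Γ.lift.props := by
    intro Γ R m h
    rw [← Formula.inst_lift]
    exact List.mem_map_of_mem h
  induction h generalizing a R m l with
  | var h => exact .var h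
  | @hyp Γ b A h hA =>
    refine .hyp (hl _ _ ?_ h) hA
    -- A hypothesis term has a universal type, while the context gives `a` an existential one.
    rintro rfl
    rw [h] at ha
    cases ha
  | @wit Γ b P h hP =>
    simp only [PTerm.catchWit]
    split_ifs with hb
    · subst hb
      -- The context determines the formula of the witness term, so it is `R`, and `R[m/α]` is
      -- available as a propositional assumption.
      rw [h] at ha
      cases ha
      exact .enc m (.hyp0 hR (hP.subst _))
    · exact .wit (hl _ _ hb h) hP
  | hyp0 h hP => exact .hyp0 h hP
  | exfalso hP => exact .exfalso hP
  | pair _ _ ih₁ ih₂ => exact .pair (ih₁ l ha hl hR) (ih₂ l ha hl hR)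
  | fst _ ih => exact .fst (ih l ha hl hR)
  | snd _ ih => exact .snd (ih l ha hl hR)
  | app _ _ ih₁ ih₂ => exact .app (ih₁ l ha hl hR) (ih₂ l ha hl hR)
  | lam _ ih => exact .lam (ih l ha hl hR)
  | inl _ ih => exact .inl (ih l ha hl hR)
  | inr _ ih => exact .inr (ih l ha hl hR)
  | case _ _ _ ih ih₁ ih₂ =>
    exact .case (ih l ha hl hR) (ih₁ l ha hl hR) (ih₂ l ha hl hR)
  | appT n _ ih => exact .appT n (ih l ha hl hR)
  | lamT _ ih => exact .lamT (ih _ (hlift ha) (hmap _ hl) (hprop hR))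
  | enc n _ ih => exact .enc n (ih l ha hl hR)
  | dest _ _ ih₁ ih₂ =>
    exact .dest (ih₁ l ha hl hR) (ih₂ _ (hlift ha) (hmap _ hl) (hprop hR))
  | em0 hP _ _ ih₁ ih₂ =>
    exact .em0 hP (ih₁ l ha hl (List.mem_cons_of_mem _ hR))
      (ih₂ l ha hl (List.mem_cons_of_mem _ hR))
  | em1 hP hQ _ _ ih₁ ih₂ =>
    exact .em1 hP hQ (ih₁ (a := a + 1) _ ha (hcons _ hl) hR)
      (ih₂ (a := a + 1) _ ha (hcons _ hl) hR)

end HasType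

namespace PTerm

/-- `raiseHyp` looks two constructors deep at `appT`. This lemma and the next provide the case split
that a structural induction needs there. -/
theorem raiseHyp_appT_hyp (a b : ℕ) (m n : L.Term ℕ) (A : Formula L) :
    (appT (hyp b A) n).raiseHyp a m = appT (hyp b A) n ∨
      b = a ∧ n = m ∧ (appT (hyp b A) n).raiseHyp a m = hyp0 (A.inst m) := by
  rw [raiseHyp]
  split_ifs with h
  · exact Or.inr ⟨h.1, h.2, rfl⟩
  · exact Or.inl rfl

theorem raiseHyp_appT_of_ne (a : ℕ) (m n : L.Term ℕ) (t : PTerm L)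
    (ht : ∀ b A, t ≠ hyp b A) : (appT t n).raiseHyp a m = appT (t.raiseHyp a m) n := by
  cases t with
  | hyp b A => exact absurd rfl (ht b A)
  | _ => simp only [raiseHyp]

end PTerm

namespace HasType

/-- Every replaced `H_a m` had type `P[m/α]`, which is now an assumption. Negativity of `P` is what
lets a propositional constant stand for it. The entry `a` stays in the context for the other
instances. -/
theorem raiseHyp {Γ : Ctx L} {t : PTerm L} {A : Formula L} (h : HasType Γ t A) {a : ℕ}
    {P : Formula L} {m : L.Term ℕ} (ha : Γ.hyps[a]? = some (Formula.all P)) (hP : P.Negative)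
    (hm : P.inst m ∈ Γ.props) : HasType Γ (t.raiseHyp a m) A := by
  have hlift : ∀ {Γ : Ctx L} {a : ℕ} {R : Formula L}, Γ.hyps[a]? = some (Formula.all R) →
      Γ.lift.hyps[a]? = some (Formula.all (R.subst (upT shiftT))) := by
    intro Γ a R h
    simp [Ctx.lift, h, Formula.lift_all]
  have hprop : ∀ {Γ : Ctx L} {R : Formula L} {m : L.Term ℕ}, R.inst m ∈ Γ.props →
      (R.subst (upT shiftT)).inst (liftTerm m) ∈ Γ.lift.props := by
    intro Γ R m h
    rw [← Formula.inst_lift]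
    exact List.mem_map_of_mem h
  induction h generalizing a P m with
  | var h => exact .var h
  | hyp h hA => exact .hyp h hA
  | wit h hQ => exact .wit h hQ
  | hyp0 h hQ => exact .hyp0 h hQ
  | exfalso hQ => exact .exfalso hQ
  | pair _ _ ih₁ ih₂ => exact .pair (ih₁ ha hP hm) (ih₂ ha hP hm)
  | fst _ ih => exact .fst (ih ha hP hm)
  | snd _ ih => exact .snd (ih ha hP hm)
  | app _ _ ih₁ ih₂ => exact .app (ih₁ ha hP hm) (ih₂ ha hP hm)
  | lam _ ih => exact .lam (ih ha hP hm)
  | inl _ ih => exact .inl (ih ha hP hm)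
  | inr _ ih => exact .inr (ih ha hP hm)
  | case _ _ _ ih ih₁ ih₂ => exact .case (ih ha hP hm) (ih₁ ha hP hm) (ih₂ ha hP hm)
  | @appT Γ t A n ht ih =>
    by_cases hh : ∃ b B, t = PTerm.hyp b B
    · obtain ⟨b, B, rfl⟩ := hh
      rcases PTerm.raiseHyp_appT_hyp a b m n B with e | ⟨rfl, rfl, e⟩
      · rw [e]; exact .appT n ht
      · rw [e]
        cases ht with
        | hyp hb hB =>
          rw [hb] at ha
          cases ha
          exact .hyp0 hm (hP.subst _)
    · rw [PTerm.raiseHyp_appT_of_ne a m n t (fun b B e => hh ⟨b, B, e⟩)]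
      exact .appT n (ih ha hP hm)
  | lamT _ ih => exact .lamT (ih (hlift ha) (hP.subst _) (hprop hm))
  | enc n _ ih => exact .enc n (ih ha hP hm)
  | dest _ _ ih₁ ih₂ =>
    exact .dest (ih₁ ha hP hm) (ih₂ (hlift ha) (hP.subst _) (hprop hm))
  | em0 hQ _ _ ih₁ ih₂ =>
    exact .em0 hQ (ih₁ ha hP (List.mem_cons_of_mem _ hm))
      (ih₂ ha hP (List.mem_cons_of_mem _ hm))
  | em1 hP' hQ _ _ ih₁ ih₂ =>
    exact .em1 hP' hQ (ih₁ (a := a + 1) ha hP hm) (ih₂ (a := a + 1) ha hP hm)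

/-- An active hypothesis subterm carries the formula that the context assigns to its variable. -/
theorem eq_of_hasActive {Γ : Ctx L} {t : PTerm L} {A : Formula L} (h : HasType Γ t A) {a : ℕ}
    {P R : Formula L} {m : L.Term ℕ} (ha : Γ.hyps[a]? = some (Formula.all R))
    (hact : t.HasActive P m a) : P = R ∧ P.Below 1 := by
  have hlift : ∀ {Γ : Ctx L} {a : ℕ} {R : Formula L}, Γ.hyps[a]? = some (Formula.all R) →
      Γ.lift.hyps[a]? = some (Formula.all (R.subst (upT shiftT))) := by
    intro Γ a R h
    simp [Ctx.lift, h, Formula.lift_all]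
  -- Under a first-order binder the context carries a lifted `R`. Activity bounds the variables of
  -- `P`, so the lifting did not change `R`.
  have down : ∀ {R : Formula L}, P = R.subst (upT shiftT) ∧ P.Below 1 → P = R ∧ P.Below 1 := by
    rintro R ⟨rfl, hb⟩
    exact ⟨Formula.subst_upT_shiftT_eq_self hb, hb⟩
  induction h generalizing a R with
  | var h => exact hact.elim
  | hyp h hA => exact hact.elim
  | wit h hP => exact hact.elim
  | hyp0 h hP => exact hact.elim
  | exfalso hP => exact hact.elim
  | pair _ _ ih₁ ih₂ => exact hact.elim (ih₁ ha) (ih₂ ha)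
  | fst _ ih => exact ih ha hact
  | snd _ ih => exact ih ha hact
  | app _ _ ih₁ ih₂ => exact hact.elim (ih₁ ha) (ih₂ ha)
  | lam _ ih => exact ih ha hact
  | inl _ ih => exact ih ha hact
  | inr _ ih => exact ih ha hact
  | case _ _ _ ih ih₁ ih₂ => exact hact.elim (ih ha) (·.elim (ih₁ ha) (ih₂ ha))
  | appT n ht ih =>
    rcases hact with ⟨rfl, -, -, hb⟩ | hact
    · cases ht with
      | hyp h hA =>
        rw [h] at ha
        cases ha
        exact ⟨rfl, hb⟩
    · exact ih ha hact
  | lamT _ ih => exact down (ih (hlift ha) hact)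
  | enc n _ ih => exact ih ha hact
  | dest _ _ ih₁ ih₂ => exact hact.elim (ih₁ ha) fun h => down (ih₂ (hlift ha) h)
  | em0 hQ _ _ ih₁ ih₂ => exact hact.elim (ih₁ ha) (ih₂ ha)
  | em1 hP' hQ _ _ ih₁ ih₂ => exact hact.elim (ih₁ (a := a + 1) ha) (ih₂ (a := a + 1) ha)

/-- Detours use the substitution lemmas, permutations use weakening by EM₀ assumptions, dropping a
branch uses strengthening, and raising an instance turns EM₁⁻ into EM₀ followed by EM₁⁻. -/
theorem rootStep {Γ : Ctx L} {t t' : PTerm L} {A : Formula L} (h : HasType Γ t A)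
    (hs : PTerm.RootStep t t') : HasType Γ t' A := by
  cases hs with
  | beta u t => cases h with | app h₁ h₂ => cases h₁ with | lam h₁ => exact h₁.instV h₂
  | betaT u m => cases h with | appT _ h => cases h with | lamT h => exact h.instFO m
  | fst u v => cases h with | fst h => cases h with | pair h₁ h₂ => exact h₁
  | snd u v => cases h with | snd h => cases h with | pair h₁ h₂ => exact h₂
  | caseL u t₁ t₂ => cases h with | case h h₁ h₂ => cases h with | inl h => exact h₁.instV h
  | caseR u t₁ t₂ => cases h with | case h h₁ h₂ => cases h with | inr h => exact h₂.instV h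
  | dest m u v =>
    cases h with
    | @dest _ _ _ B _ h₁ h₂ =>
      cases h₁ with
      | enc _ h₁ =>
        have h₃ := h₂.substT (instT m)
        have e : (Γ.lift.addVar B).subst (instT m) = Γ.addVar (B.inst m) := by
          change (Γ.lift.subst (instT m)).addVar (B.inst m) = _
          rw [Ctx.lift_subst_instT]
        rw [e] at h₃
        have e' : A.lift.subst (instT m) = A := A.lift_inst m
        rw [e'] at h₃
        exact h₃.instV h₁
  | parApp u v w =>
    cases h with
    | app h₁ h₂ =>
      cases h₁ with
      -- The argument is copied into both branches, and each copy must be weakened by the assumption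
      -- of its branch.
      | em0 hP hu hv => exact .em0 hP (.app hu (h₂.addProp _)) (.app hv (h₂.addProp _))
  | parAppT u v m =>
    cases h with
    | appT _ h₁ => cases h₁ with | em0 hP hu hv => exact .em0 hP (.appT m hu) (.appT m hv)
  | parFst u v =>
    cases h with
    | fst h₁ => cases h₁ with | em0 hP hu hv => exact .em0 hP (.fst hu) (.fst hv)
  | parSnd u v =>
    cases h with
    | snd h₁ => cases h₁ with | em0 hP hu hv => exact .em0 hP (.snd hu) (.snd hv)
  | parCase u v w₁ w₂ =>
    cases h with
    | case h h₁ h₂ =>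
      cases h with
      | em0 hP hu hv =>
        exact .em0 hP (.case hu (h₁.addProp _) (h₂.addProp _))
          (.case hv (h₁.addProp _) (h₂.addProp _))
  | parDest u v w =>
    cases h with
    | dest h₁ h₂ =>
      cases h₁ with
      | em0 hP hu hv =>
        exact .em0 hP (.dest hu (h₂.addProp _)) (.dest hv (h₂.addProp _))
  | emDrop u u' v hu =>
    subst hu
    cases h with | em1 hP hQ h₁ h₂ => exact h₁.of_liftH
  | emRaise u v P m hact hu hv =>
    cases h with
    | @em1 _ _ _ R Q hR hQ h₁ h₂ =>
      obtain ⟨rfl, -⟩ := h₁.eq_of_hasActive (a := 0) rfl hact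
      have hin : P.inst m ∈ (Γ.addProp (P.inst m)).props := List.mem_cons_self
      -- The cut formula of the new EM₀ is `P[m/α]`. Its negation is by definition the instance at
      -- `m` of the matrix `¬P` that the caught witness terms carry.
      refine .em0 (P := P.inst m) (hR.subst _) ?_
        (.em1 hR hQ ((h₁.addProp (P.inst m)).raiseHyp (a := 0) rfl hR hin) (h₂.addProp _))
      refine (h₂.addProp (P.inst m).neg).catchWit (a := 0) (R := P.neg) Γ.hyps rfl ?_
        List.mem_cons_self
      intro b B hb hB
      cases b with
      | zero => exact absurd rfl hb
      | succ b => exact hB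

theorem step {Γ : Ctx L} {t t' : PTerm L} {A : Formula L} (h : HasType Γ t A)
    (hs : PTerm.Step t t') : HasType Γ t' A := by
  induction hs generalizing Γ A with
  | root hs => exact h.rootStep hs
  | appL u _ ih => cases h with | app h₁ h₂ => exact .app (ih h₁) h₂
  | appR t _ ih => cases h with | app h₁ h₂ => exact .app h₁ (ih h₂)
  | appT m _ ih => cases h with | appT _ h => exact .appT m (ih h)
  | lam _ ih => cases h with | lam h => exact .lam (ih h)
  | lamT _ ih => cases h with | lamT h => exact .lamT (ih h)
  | pairL u _ ih => cases h with | pair h₁ h₂ => exact .pair (ih h₁) h₂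
  | pairR t _ ih => cases h with | pair h₁ h₂ => exact .pair h₁ (ih h₂)
  | fst _ ih => cases h with | fst h => exact .fst (ih h)
  | snd _ ih => cases h with | snd h => exact .snd (ih h)
  | inl _ ih => cases h with | inl h => exact .inl (ih h)
  | inr _ ih => cases h with | inr h => exact .inr (ih h)
  | case₀ u v _ ih => cases h with | case h h₁ h₂ => exact .case (ih h) h₁ h₂
  | case₁ t v _ ih => cases h with | case h h₁ h₂ => exact .case h (ih h₁) h₂
  | case₂ t u _ ih => cases h with | case h h₁ h₂ => exact .case h h₁ (ih h₂)
  | enc m _ ih => cases h with | enc _ h => exact .enc m (ih h)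
  | destL u _ ih => cases h with | dest h₁ h₂ => exact .dest (ih h₁) h₂
  | destR t _ ih => cases h with | dest h₁ h₂ => exact .dest h₁ (ih h₂)
  | parL v _ ih => cases h with | em0 hP h₁ h₂ => exact .em0 hP (ih h₁) h₂
  | parR u _ ih => cases h with | em0 hP h₁ h₂ => exact .em0 hP h₁ (ih h₂)
  | emL v _ ih => cases h with | em1 hP hQ h₁ h₂ => exact .em1 hP hQ (ih h₁) h₂
  | emR u _ ih => cases h with | em1 hP hQ h₁ h₂ => exact .em1 hP hQ h₁ (ih h₂)

end HasType

end Typing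

end ILEM

namespace ILEM

/-! ### Preservation of quasi-closedness under reduction. -/

section QuasiClosedness

variable {L : FirstOrder.Language.{u, v}}

namespace PTerm

theorem QuasiClosedAt.substT {i i' j k : ℕ} {t : PTerm L} {σ : ℕ → L.Term ℕ}
    (h : t.QuasiClosedAt i j k) (hσ : ∀ n < i, TermBelow i' (σ n)) :
    (t.substT σ).QuasiClosedAt i' j k := by
  induction t generalizing i i' j k σ with
  | var x => exact h
  | app t u ih₁ ih₂ => exact ⟨ih₁ h.1 hσ, ih₂ h.2 hσ⟩
  | appT t m ih => exact ⟨ih h.1 hσ, h.2.subst hσ⟩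
  | lam t ih => exact ih (j := j + 1) h hσ
  | lamT t ih => exact ih (i := i + 1) (i' := i' + 1) h (termBelow_upT hσ)
  | pair t u ih₁ ih₂ => exact ⟨ih₁ h.1 hσ, ih₂ h.2 hσ⟩
  | fst t ih => exact ih (j := j) h hσ
  | snd t ih => exact ih (j := j) h hσ
  | inl t ih => exact ih (j := j) h hσ
  | inr t ih => exact ih (j := j) h hσ
  | case t u v ih ih₁ ih₂ => exact ⟨ih h.1 hσ, ih₁ h.2.1 hσ, ih₂ h.2.2 hσ⟩
  | enc m t ih => exact ⟨h.1.subst hσ, ih h.2 hσ⟩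
  | dest t u ih₁ ih₂ => exact ⟨ih₁ h.1 hσ, ih₂ h.2 (termBelow_upT hσ)⟩
  | par u v ih₁ ih₂ => exact ⟨ih₁ h.1 hσ, ih₂ h.2 hσ⟩
  | em u v ih₁ ih₂ => exact ⟨ih₁ h.1 hσ, ih₂ h.2 hσ⟩
  | hyp a A => exact ⟨h.1.subst hσ, fun ha => (h.2 ha).subst σ⟩
  | wit a P => exact ⟨h.1.subst hσ, h.2⟩
  | hyp0 P => exact Formula.Below.subst h hσ

theorem QuasiClosedAt.renV {i j j' k : ℕ} {t : PTerm L} {ρ : ℕ → ℕ}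
    (h : t.QuasiClosedAt i j k) (hρ : ∀ x < j, ρ x < j') : (t.renV ρ).QuasiClosedAt i j' k := by
  have up : ∀ {j j' : ℕ} {ρ : ℕ → ℕ}, (∀ x < j, ρ x < j') → ∀ x < j + 1, upR ρ x < j' + 1 := by
    intro j j' ρ h x hx
    cases x with
    | zero => exact Nat.succ_pos _
    | succ x => exact Nat.succ_lt_succ (h x (by omega))
  induction t generalizing i j j' k ρ with
  | var x => exact hρ x h
  | app t u ih₁ ih₂ => exact ⟨ih₁ h.1 hρ, ih₂ h.2 hρ⟩
  | appT t m ih => exact ⟨ih h.1 hρ, h.2⟩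
  | lam t ih => exact ih (j := j + 1) (j' := j' + 1) h (up hρ)
  | lamT t ih => exact ih (i := i + 1) h hρ
  | pair t u ih₁ ih₂ => exact ⟨ih₁ h.1 hρ, ih₂ h.2 hρ⟩
  | fst t ih => exact ih (i := i) h hρ
  | snd t ih => exact ih (i := i) h hρ
  | inl t ih => exact ih (i := i) h hρ
  | inr t ih => exact ih (i := i) h hρ
  | case t u v ih ih₁ ih₂ => exact ⟨ih h.1 hρ, ih₁ h.2.1 (up hρ), ih₂ h.2.2 (up hρ)⟩
  | enc m t ih => exact ⟨h.1, ih h.2 hρ⟩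
  | dest t u ih₁ ih₂ => exact ⟨ih₁ h.1 hρ, ih₂ h.2 (up hρ)⟩
  | par u v ih₁ ih₂ => exact ⟨ih₁ h.1 hρ, ih₂ h.2 hρ⟩
  | em u v ih₁ ih₂ => exact ⟨ih₁ h.1 hρ, ih₂ h.2 hρ⟩
  | hyp a A => exact h
  | wit a P => exact h
  | hyp0 P => exact h

/-- An equivalence is needed: one direction weakens substituted terms under `∥ₐ`, the other removes
the binder when `u ∥ₐ v` drops `v`. -/
theorem quasiClosedAt_renH {i j k k' : ℕ} {t : PTerm L} {ρ : ℕ → ℕ}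
    (hρ : ∀ a, ρ a < k' ↔ a < k) : (t.renH ρ).QuasiClosedAt i j k' ↔ t.QuasiClosedAt i j k := by
  have up : ∀ {k k' : ℕ} {ρ : ℕ → ℕ}, (∀ a, ρ a < k' ↔ a < k) →
      ∀ a, upR ρ a < k' + 1 ↔ a < k + 1 := by
    intro k k' ρ h a
    cases a with
    | zero => simp [upR]
    | succ a => simpa [upR] using h a
  induction t generalizing i j k k' ρ with
  | hyp a A => simp only [PTerm.renH, QuasiClosedAt, ← not_lt, hρ]
  | wit a P => simp only [PTerm.renH, QuasiClosedAt, hρ]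
  | var | hyp0 => rfl
  | app t u ih₁ ih₂ | pair t u ih₁ ih₂ | par t u ih₁ ih₂ | dest t u ih₁ ih₂ =>
    exact and_congr (ih₁ hρ) (ih₂ hρ)
  | em t u ih₁ ih₂ => exact and_congr (ih₁ (up hρ)) (ih₂ (up hρ))
  | appT t m ih => exact and_congr_left' (ih hρ)
  | enc m t ih => exact and_congr_right' (ih hρ)
  | case t u v ih ih₁ ih₂ => exact and_congr (ih hρ) (and_congr (ih₁ hρ) (ih₂ hρ))
  | lam t ih | lamT t ih | fst t ih | snd t ih | inl t ih | inr t ih => exact ih hρ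

theorem QuasiClosedAt.substV {i j j' k : ℕ} {t : PTerm L} {τ : ℕ → PTerm L}
    (h : t.QuasiClosedAt i j k) (hτ : ∀ x < j, (τ x).QuasiClosedAt i j' k) :
    (t.substV τ).QuasiClosedAt i j' k := by
  have up : ∀ {i j j' k : ℕ} {τ : ℕ → PTerm L}, (∀ x < j, (τ x).QuasiClosedAt i j' k) →
      ∀ x < j + 1, (upV τ x).QuasiClosedAt i (j' + 1) k := by
    intro i j j' k τ h x hx
    cases x with
    | zero => exact Nat.succ_pos _
    | succ x => exact (h x (by omega)).renV fun y hy => Nat.succ_lt_succ hy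
  have lft : ∀ {i j j' k : ℕ} {τ : ℕ → PTerm L}, (∀ x < j, (τ x).QuasiClosedAt i j' k) →
      ∀ x < j, (τ x).liftT.QuasiClosedAt (i + 1) j' k :=
    fun h x hx => (h x hx).substT (termBelow_shiftT _)
  have lfH : ∀ {i j j' k : ℕ} {τ : ℕ → PTerm L}, (∀ x < j, (τ x).QuasiClosedAt i j' k) →
      ∀ x < j, (τ x).liftH.QuasiClosedAt i j' (k + 1) :=
    fun h x hx => (quasiClosedAt_renH fun a => Nat.succ_lt_succ_iff).2 (h x hx)
  induction t generalizing i j j' k τ with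
  | var x => exact hτ x h
  | app t u ih₁ ih₂ => exact ⟨ih₁ h.1 hτ, ih₂ h.2 hτ⟩
  | appT t m ih => exact ⟨ih h.1 hτ, h.2⟩
  | lam t ih => exact ih (j := j + 1) (j' := j' + 1) h (up hτ)
  | lamT t ih => exact ih (i := i + 1) h (lft hτ)
  | pair t u ih₁ ih₂ => exact ⟨ih₁ h.1 hτ, ih₂ h.2 hτ⟩
  | fst t ih => exact ih (i := i) h hτ
  | snd t ih => exact ih (i := i) h hτ
  | inl t ih => exact ih (i := i) h hτ
  | inr t ih => exact ih (i := i) h hτ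
  | case t u v ih ih₁ ih₂ => exact ⟨ih h.1 hτ, ih₁ h.2.1 (up hτ), ih₂ h.2.2 (up hτ)⟩
  | enc m t ih => exact ⟨h.1, ih h.2 hτ⟩
  | dest t u ih₁ ih₂ => exact ⟨ih₁ h.1 hτ, ih₂ h.2 (up (lft hτ))⟩
  | par u v ih₁ ih₂ => exact ⟨ih₁ h.1 hτ, ih₂ h.2 hτ⟩
  | em u v ih₁ ih₂ => exact ⟨ih₁ h.1 (lfH hτ), ih₂ h.2 (lfH hτ)⟩
  | hyp a A => exact h
  | wit a P => exact h
  | hyp0 P => exact h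

theorem QuasiClosedAt.instV {i j k : ℕ} {u t : PTerm L} (hu : u.QuasiClosedAt i (j + 1) k)
    (ht : t.QuasiClosedAt i j k) : (u.instV t).QuasiClosedAt i j k := by
  refine hu.substV fun x hx => ?_
  cases x with
  | zero => exact ht
  | succ x => exact Nat.lt_of_succ_lt_succ hx

theorem QuasiClosedAt.instFO {i j k : ℕ} {u : PTerm L} {m : L.Term ℕ}
    (hu : u.QuasiClosedAt (i + 1) j k) (hm : TermBelow i m) :
    (u.instFO m).QuasiClosedAt i j k :=
  hu.substT (termBelow_instT hm)

/-- One bound hypothesis variable disappears together with its witness terms. A leftover `H_a` would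
become free without being known to be simply universal; `OnlyWit` excludes this. -/
theorem QuasiClosedAt.catchWit {i j k a : ℕ} {t : PTerm L} {m : L.Term ℕ}
    (h : t.QuasiClosedAt i j (k + 1)) (ha : a ≤ k) (hm : TermBelow i m) (ht : t.OnlyWit a) :
    (t.catchWit a m).QuasiClosedAt i j k := by
  induction t generalizing i j k a m with
  | var x => exact h
  | app t u ih₁ ih₂ => exact ⟨ih₁ h.1 ha hm ht.1, ih₂ h.2 ha hm ht.2⟩
  | appT t n ih => exact ⟨ih h.1 ha hm ht, h.2⟩
  | lam t ih => exact ih (j := j + 1) h ha hm ht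
  | lamT t ih => exact ih (i := i + 1) h ha (termBelow_liftTerm.2 hm) ht
  | pair t u ih₁ ih₂ => exact ⟨ih₁ h.1 ha hm ht.1, ih₂ h.2 ha hm ht.2⟩
  | fst t ih => exact ih (i := i) h ha hm ht
  | snd t ih => exact ih (i := i) h ha hm ht
  | inl t ih => exact ih (i := i) h ha hm ht
  | inr t ih => exact ih (i := i) h ha hm ht
  | case t u v ih ih₁ ih₂ =>
    exact ⟨ih h.1 ha hm ht.1, ih₁ h.2.1 ha hm ht.2.1, ih₂ h.2.2 ha hm ht.2.2⟩
  | enc n t ih => exact ⟨h.1, ih h.2 ha hm ht⟩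
  | dest t u ih₁ ih₂ =>
    exact ⟨ih₁ h.1 ha hm ht.1, ih₂ h.2 ha (termBelow_liftTerm.2 hm) ht.2⟩
  | par u v ih₁ ih₂ => exact ⟨ih₁ h.1 ha hm ht.1, ih₂ h.2 ha hm ht.2⟩
  | em u v ih₁ ih₂ =>
    exact ⟨ih₁ h.1 (Nat.succ_le_succ ha) hm ht.1, ih₂ h.2 (Nat.succ_le_succ ha) hm ht.2⟩
  | hyp b A =>
    refine ⟨h.1, fun hb => h.2 ?_⟩
    simp only [dropIdx] at hb
    -- If `a < b`, the index drops by one, just as the bound does. If `b < a`, then `b < a ≤ k`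
    -- contradicts that `b` is free.
    have : b ≠ a := ht
    split_ifs at hb <;> omega
  | wit b P =>
    have hP : P.Below (i + 1) := h.1
    have hb : b < k + 1 := h.2
    simp only [PTerm.catchWit]
    split_ifs with hba
    · exact ⟨hm, hP.subst (termBelow_instT hm)⟩
    · refine ⟨hP, ?_⟩
      simp only [dropIdx]
      split_ifs <;> omega
  | hyp0 P => exact h

theorem QuasiClosedAt.raiseHyp {i j k a : ℕ} {t : PTerm L} {m : L.Term ℕ}
    (h : t.QuasiClosedAt i j k) (hm : TermBelow i m) :
    (t.raiseHyp a m).QuasiClosedAt i j k := by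
  induction t generalizing i j k a m with
  | var x => exact h
  | app t u ih₁ ih₂ => exact ⟨ih₁ h.1 hm, ih₂ h.2 hm⟩
  | appT t n ih =>
    by_cases hh : ∃ b B, t = PTerm.hyp b B
    · obtain ⟨b, B, rfl⟩ := hh
      rcases raiseHyp_appT_hyp a b m n B with e | ⟨rfl, rfl, e⟩
      · rwa [e]
      · rw [e]
        have hB : B.Below (i + 1) := h.1.1
        exact hB.subst (termBelow_instT hm)
    · rw [raiseHyp_appT_of_ne a m n t (fun b B e => hh ⟨b, B, e⟩)]
      exact ⟨ih h.1 hm, h.2⟩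
  | lam t ih => exact ih (j := j + 1) h hm
  | lamT t ih => exact ih (i := i + 1) h (termBelow_liftTerm.2 hm)
  | pair t u ih₁ ih₂ => exact ⟨ih₁ h.1 hm, ih₂ h.2 hm⟩
  | fst t ih => exact ih (i := i) h hm
  | snd t ih => exact ih (i := i) h hm
  | inl t ih => exact ih (i := i) h hm
  | inr t ih => exact ih (i := i) h hm
  | case t u v ih ih₁ ih₂ => exact ⟨ih h.1 hm, ih₁ h.2.1 hm, ih₂ h.2.2 hm⟩
  | enc n t ih => exact ⟨h.1, ih h.2 hm⟩
  | dest t u ih₁ ih₂ => exact ⟨ih₁ h.1 hm, ih₂ h.2 (termBelow_liftTerm.2 hm)⟩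
  | par u v ih₁ ih₂ => exact ⟨ih₁ h.1 hm, ih₂ h.2 hm⟩
  | em u v ih₁ ih₂ => exact ⟨ih₁ h.1 hm, ih₂ h.2 hm⟩
  | hyp b A => exact h
  | wit b P => exact h
  | hyp0 P => exact h

/-- The closedness demanded of an active instance lets `m` be carried out of the binders around it
in `u` and inserted into `v`. -/
theorem HasActive.termBelow {P : Formula L} {m : L.Term ℕ} {a : ℕ} {t : PTerm L}
    (h : t.HasActive P m a) : TermBelow 0 m := by
  induction t generalizing a with
  | app t u ih₁ ih₂ => exact h.elim ih₁ ih₂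
  | appT t n ih => exact h.elim (·.2.2.1) ih
  | pair t u ih₁ ih₂ => exact h.elim ih₁ ih₂
  | case t u v ih ih₁ ih₂ => exact h.elim ih (·.elim ih₁ ih₂)
  | dest t u ih₁ ih₂ => exact h.elim ih₁ ih₂
  | par u v ih₁ ih₂ => exact h.elim ih₁ ih₂
  | em u v ih₁ ih₂ => exact h.elim ih₁ ih₂
  | var | hyp | wit | hyp0 => exact h.elim
  | lam t ih | lamT t ih | fst t ih | snd t ih | inl t ih | inr t ih => exact ih (a := a) h
  | enc n t ih => exact ih (a := a) h

theorem QuasiClosedAt.rootStep {i j k : ℕ} {t t' : PTerm L} (h : t.QuasiClosedAt i j k)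
    (hs : RootStep t t') : t'.QuasiClosedAt i j k := by
  cases hs with
  | beta u t => exact QuasiClosedAt.instV h.1 h.2
  | betaT u m => exact QuasiClosedAt.instFO h.1 h.2
  | fst u v => exact And.left h
  | snd u v => exact And.right h
  | caseL u t₁ t₂ => exact QuasiClosedAt.instV h.2.1 h.1
  | caseR u t₁ t₂ => exact QuasiClosedAt.instV h.2.2 h.1
  | dest m u v => exact (QuasiClosedAt.instFO h.2 h.1.1).instV h.1.2
  | parApp u v w => exact ⟨⟨h.1.1, h.2⟩, ⟨h.1.2, h.2⟩⟩
  | parAppT u v m => exact ⟨⟨h.1.1, h.2⟩, ⟨h.1.2, h.2⟩⟩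
  | parFst u v => exact h
  | parSnd u v => exact h
  | parCase u v w₁ w₂ => exact ⟨⟨h.1.1, h.2⟩, ⟨h.1.2, h.2⟩⟩
  | parDest u v w => exact ⟨⟨h.1.1, h.2⟩, ⟨h.1.2, h.2⟩⟩
  | emDrop u u' v hu =>
    subst hu
    exact (quasiClosedAt_renH fun a => Nat.succ_lt_succ_iff).1 h.1
  | emRaise u v P m hact hu hv =>
    have hm : TermBelow i m := hact.termBelow.mono (Nat.zero_le i)
    exact ⟨QuasiClosedAt.catchWit h.2 (Nat.zero_le k) hm hv,
      QuasiClosedAt.raiseHyp h.1 hm, h.2⟩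

theorem QuasiClosedAt.step {i j k : ℕ} {t t' : PTerm L} (h : t.QuasiClosedAt i j k)
    (hs : Step t t') : t'.QuasiClosedAt i j k := by
  induction hs generalizing i j k with
  | root hs => exact h.rootStep hs
  | appL u _ ih => exact ⟨ih h.1, h.2⟩
  | appR t _ ih => exact ⟨h.1, ih h.2⟩
  | appT m _ ih => exact ⟨ih h.1, h.2⟩
  | lam _ ih => exact ih (j := j + 1) h
  | lamT _ ih => exact ih (i := i + 1) h
  | pairL u _ ih => exact ⟨ih h.1, h.2⟩
  | pairR t _ ih => exact ⟨h.1, ih h.2⟩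
  | fst _ ih => exact ih (i := i) h
  | snd _ ih => exact ih (i := i) h
  | inl _ ih => exact ih (i := i) h
  | inr _ ih => exact ih (i := i) h
  | case₀ u v _ ih => exact ⟨ih h.1, h.2⟩
  | case₁ t v _ ih => exact ⟨h.1, ih h.2.1, h.2.2⟩
  | case₂ t u _ ih => exact ⟨h.1, h.2.1, ih h.2.2⟩
  | enc m _ ih => exact ⟨h.1, ih h.2⟩
  | destL u _ ih => exact ⟨ih h.1, h.2⟩
  | destR t _ ih => exact ⟨h.1, ih h.2⟩
  | parL v _ ih => exact ⟨ih h.1, h.2⟩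
  | parR u _ ih => exact ⟨h.1, ih h.2⟩
  | emL v _ ih => exact ⟨ih h.1, h.2⟩
  | emR u _ ih => exact ⟨h.1, ih h.2⟩

theorem QuasiClosed.reduces {t t' : PTerm L} (h : t.QuasiClosed) (hs : t.Reduces t') :
    t'.QuasiClosed := by
  induction hs with
  | refl => exact h
  | tail _ hs ih => exact QuasiClosedAt.step ih hs

end PTerm

theorem HasType.reduces {Γ : Ctx L} {t t' : PTerm L} {A : Formula L} (h : HasType Γ t A)
    (hs : t.Reduces t') : HasType Γ t' A := by
  induction hs with
  | refl => exact h
  | tail _ hs ih => exact ih.step hs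

end QuasiClosedness

/-! ### Shape of quasi-closed normal terms. -/

section NormalForms

variable {L : FirstOrder.Language.{u, v}}

namespace HasType

/-- A universal entry of the context cannot type a witness term. Together with `onlyWit`, this shows
that the exception substitutions are always defined in a typed `u ∥ₐ v`. -/
theorem onlyHyp {Γ : Ctx L} {t : PTerm L} {A : Formula L} (h : HasType Γ t A) {a : ℕ}
    (ha : ∃ R, Γ.hyps[a]? = some (Formula.all R)) : t.OnlyHyp a := by
  have hlift : ∀ {Γ : Ctx L} {a : ℕ}, (∃ R, Γ.hyps[a]? = some (Formula.all R)) →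
      ∃ R, Γ.lift.hyps[a]? = some (Formula.all R) := by
    rintro Γ a ⟨R, h⟩
    exact ⟨_, by simp [Ctx.lift, h, Formula.lift_all]; rfl⟩
  induction h generalizing a with
  | var | hyp | hyp0 | exfalso => trivial
  | wit h hP =>
    rintro rfl
    obtain ⟨R, hR⟩ := ha
    rw [h] at hR
    cases hR
  | pair _ _ ih₁ ih₂ => exact ⟨ih₁ ha, ih₂ ha⟩
  | fst _ ih => exact ih ha
  | snd _ ih => exact ih ha
  | app _ _ ih₁ ih₂ => exact ⟨ih₁ ha, ih₂ ha⟩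
  | lam _ ih => exact ih ha
  | inl _ ih => exact ih ha
  | inr _ ih => exact ih ha
  | case _ _ _ ih ih₁ ih₂ => exact ⟨ih ha, ih₁ ha, ih₂ ha⟩
  | appT n _ ih => exact ih ha
  | lamT _ ih => exact ih (hlift ha)
  | enc n _ ih => exact ih ha
  | dest _ _ ih₁ ih₂ => exact ⟨ih₁ ha, ih₂ (hlift ha)⟩
  | em0 hQ _ _ ih₁ ih₂ => exact ⟨ih₁ ha, ih₂ ha⟩
  | em1 hP hQ _ _ ih₁ ih₂ => exact ⟨ih₁ (a := a + 1) ha, ih₂ (a := a + 1) ha⟩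

theorem onlyWit {Γ : Ctx L} {t : PTerm L} {A : Formula L} (h : HasType Γ t A) {a : ℕ}
    (ha : ∃ R, Γ.hyps[a]? = some (Formula.ex R)) : t.OnlyWit a := by
  have hlift : ∀ {Γ : Ctx L} {a : ℕ}, (∃ R, Γ.hyps[a]? = some (Formula.ex R)) →
      ∃ R, Γ.lift.hyps[a]? = some (Formula.ex R) := by
    rintro Γ a ⟨R, h⟩
    exact ⟨_, by simp [Ctx.lift, h, Formula.lift_ex]; rfl⟩
  induction h generalizing a with
  | var | wit | hyp0 | exfalso => trivial
  | hyp h hP =>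
    rintro rfl
    obtain ⟨R, hR⟩ := ha
    rw [h] at hR
    cases hR
  | pair _ _ ih₁ ih₂ => exact ⟨ih₁ ha, ih₂ ha⟩
  | fst _ ih => exact ih ha
  | snd _ ih => exact ih ha
  | app _ _ ih₁ ih₂ => exact ⟨ih₁ ha, ih₂ ha⟩
  | lam _ ih => exact ih ha
  | inl _ ih => exact ih ha
  | inr _ ih => exact ih ha
  | case _ _ _ ih ih₁ ih₂ => exact ⟨ih ha, ih₁ ha, ih₂ ha⟩
  | appT n _ ih => exact ih ha
  | lamT _ ih => exact ih (hlift ha)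
  | enc n _ ih => exact ih ha
  | dest _ _ ih₁ ih₂ => exact ⟨ih₁ ha, ih₂ (hlift ha)⟩
  | em0 hQ _ _ ih₁ ih₂ => exact ⟨ih₁ ha, ih₂ ha⟩
  | em1 hP hQ _ _ ih₁ ih₂ => exact ⟨ih₁ (a := a + 1) ha, ih₂ (a := a + 1) ha⟩

/-- In a typed term a hypothesis variable of universal type need not be counted as bound. -/
theorem quasiClosedAt_of_succ {Γ : Ctx L} {t : PTerm L} {A : Formula L} (h : HasType Γ t A)
    {i j k : ℕ} (hq : t.QuasiClosedAt i j (k + 1)) (ht : t.OnlyHyp k) :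
    t.QuasiClosedAt i j k := by
  induction h generalizing i j k with
  | var | hyp0 | exfalso => exact hq
  | hyp h hA => exact ⟨hq.1, fun _ => hA⟩
  | wit h hP => exact ⟨hq.1, lt_of_le_of_ne (Nat.le_of_lt_succ hq.2) ht⟩
  | pair _ _ ih₁ ih₂ => exact ⟨ih₁ hq.1 ht.1, ih₂ hq.2 ht.2⟩
  | fst _ ih => exact ih (i := i) hq ht
  | snd _ ih => exact ih (i := i) hq ht
  | app _ _ ih₁ ih₂ => exact ⟨ih₁ hq.1 ht.1, ih₂ hq.2 ht.2⟩
  | lam _ ih => exact ih (j := j + 1) hq ht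
  | inl _ ih => exact ih (i := i) hq ht
  | inr _ ih => exact ih (i := i) hq ht
  | case _ _ _ ih ih₁ ih₂ => exact ⟨ih hq.1 ht.1, ih₁ hq.2.1 ht.2.1, ih₂ hq.2.2 ht.2.2⟩
  | appT n _ ih => exact ⟨ih hq.1 ht, hq.2⟩
  | lamT _ ih => exact ih (i := i + 1) hq ht
  | enc n _ ih => exact ⟨hq.1, ih hq.2 ht⟩
  | dest _ _ ih₁ ih₂ => exact ⟨ih₁ hq.1 ht.1, ih₂ hq.2 ht.2⟩
  | em0 hQ _ _ ih₁ ih₂ => exact ⟨ih₁ hq.1 ht.1, ih₂ hq.2 ht.2⟩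
  | em1 hP hQ _ _ ih₁ ih₂ => exact ⟨ih₁ hq.1 ht.1, ih₂ hq.2 ht.2⟩

end HasType

namespace PTerm

/-- The renaming of hypothesis variables that skips `a`. -/
def skip : ℕ → ℕ → ℕ
  | 0 => Nat.succ
  | a + 1 => upR (skip a)

theorem exists_skip_eq {a b : ℕ} (h : b ≠ a) : ∃ c, skip a c = b := by
  induction a generalizing b with
  | zero => exact ⟨b - 1, by simp only [skip]; omega⟩
  | succ a ih =>
    cases b with
    | zero => exact ⟨0, rfl⟩
    | succ b =>
      obtain ⟨c, hc⟩ := ih (b := b) (by omega)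
      exact ⟨c + 1, congrArg Nat.succ hc⟩

/-- A term in which the hypothesis variable `a` is not free is a renamed term. -/
theorem exists_renH_skip {a : ℕ} {t : PTerm L} (h₁ : t.OnlyHyp a) (h₂ : t.OnlyWit a) :
    ∃ t' : PTerm L, t'.renH (skip a) = t := by
  induction t generalizing a with
  | var x => exact ⟨var x, rfl⟩
  | app t u ih₁ ih₂ =>
    obtain ⟨t', rfl⟩ := ih₁ h₁.1 h₂.1
    obtain ⟨u', rfl⟩ := ih₂ h₁.2 h₂.2
    exact ⟨app t' u', rfl⟩
  | appT t m ih => obtain ⟨t', rfl⟩ := ih (a := a) h₁ h₂; exact ⟨appT t' m, rfl⟩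
  | lam t ih => obtain ⟨t', rfl⟩ := ih (a := a) h₁ h₂; exact ⟨lam t', rfl⟩
  | lamT t ih => obtain ⟨t', rfl⟩ := ih (a := a) h₁ h₂; exact ⟨lamT t', rfl⟩
  | pair t u ih₁ ih₂ =>
    obtain ⟨t', rfl⟩ := ih₁ h₁.1 h₂.1
    obtain ⟨u', rfl⟩ := ih₂ h₁.2 h₂.2
    exact ⟨pair t' u', rfl⟩
  | fst t ih => obtain ⟨t', rfl⟩ := ih (a := a) h₁ h₂; exact ⟨fst t', rfl⟩
  | snd t ih => obtain ⟨t', rfl⟩ := ih (a := a) h₁ h₂; exact ⟨snd t', rfl⟩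
  | inl t ih => obtain ⟨t', rfl⟩ := ih (a := a) h₁ h₂; exact ⟨inl t', rfl⟩
  | inr t ih => obtain ⟨t', rfl⟩ := ih (a := a) h₁ h₂; exact ⟨inr t', rfl⟩
  | case t u v ih ih₁ ih₂ =>
    obtain ⟨t', rfl⟩ := ih h₁.1 h₂.1
    obtain ⟨u', rfl⟩ := ih₁ h₁.2.1 h₂.2.1
    obtain ⟨v', rfl⟩ := ih₂ h₁.2.2 h₂.2.2
    exact ⟨case t' u' v', rfl⟩
  | enc m t ih => obtain ⟨t', rfl⟩ := ih (a := a) h₁ h₂; exact ⟨enc m t', rfl⟩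
  | dest t u ih₁ ih₂ =>
    obtain ⟨t', rfl⟩ := ih₁ h₁.1 h₂.1
    obtain ⟨u', rfl⟩ := ih₂ h₁.2 h₂.2
    exact ⟨dest t' u', rfl⟩
  | par u v ih₁ ih₂ =>
    obtain ⟨u', rfl⟩ := ih₁ h₁.1 h₂.1
    obtain ⟨v', rfl⟩ := ih₂ h₁.2 h₂.2
    exact ⟨par u' v', rfl⟩
  | em u v ih₁ ih₂ =>
    obtain ⟨u', rfl⟩ := ih₁ h₁.1 h₂.1
    obtain ⟨v', rfl⟩ := ih₂ h₁.2 h₂.2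
    exact ⟨em u' v', rfl⟩
  | hyp b A => obtain ⟨c, rfl⟩ := exists_skip_eq h₂; exact ⟨hyp c A, rfl⟩
  | wit b P => obtain ⟨c, rfl⟩ := exists_skip_eq h₁; exact ⟨wit c P, rfl⟩
  | hyp0 P => exact ⟨hyp0 P, rfl⟩

/-- Terms whose outermost constructor is not an introduction, nor a classical rule. -/
def Neutral : PTerm L → Prop
  | var _ | app _ _ | appT _ _ | fst _ | snd _ | case _ _ _ | dest _ _ => True
  | hyp _ _ | wit _ _ | hyp0 _ => True
  | _ => False

/-- The hypothesis variable `a` is active in `t`, or is the variable of no hypothesis term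
in `t`. -/
def ActiveOrAbsent (a : ℕ) (t : PTerm L) : Prop :=
  (∃ P m, t.HasActive P m a) ∨ t.OnlyWit a

theorem ActiveOrAbsent.combine {a : ℕ} {t u s : PTerm L} (ht : t.ActiveOrAbsent a)
    (hu : u.ActiveOrAbsent a)
    (hs : ∀ P m, t.HasActive P m a ∨ u.HasActive P m a → s.HasActive P m a)
    (hw : t.OnlyWit a → u.OnlyWit a → s.OnlyWit a) : s.ActiveOrAbsent a := by
  rcases ht with ⟨P, m, h⟩ | ht
  · exact Or.inl ⟨P, m, hs P m (Or.inl h)⟩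
  · rcases hu with ⟨P, m, h⟩ | hu
    · exact Or.inl ⟨P, m, hs P m (Or.inr h)⟩
    · exact Or.inr (hw ht hu)

end PTerm

namespace Formula

/-- Negative formulas and their existential quantifications. -/
def ExNegative (C : Formula L) : Prop := C.Negative ∨ ∃ Q : Formula L, Q.Negative ∧ C = ex Q

end Formula

/-- The bare term `H_a` is the one exception to the dichotomy between active and absent. Its
universal type removes that exception wherever the type is negative or `∃β Q` with `Q` negative. -/
theorem HasType.not_exNegative_hyp {Γ : Ctx L} {a : ℕ} {A C : Formula L}
    (h : HasType Γ (PTerm.hyp a A) C) : ¬ C.ExNegative := by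
  rintro (hC | ⟨Q, -, rfl⟩)
  · cases h with | hyp => exact hC
  · cases h

theorem HasType.activeOrAbsent_of_exNegative {Γ : Ctx L} {a : ℕ} {t : PTerm L} {C : Formula L}
    (h : HasType Γ t C) (hC : C.ExNegative)
    (ht : t.ActiveOrAbsent a ∨ ∃ A, t = PTerm.hyp a A) : t.ActiveOrAbsent a := by
  rcases ht with ht | ⟨A, rfl⟩
  · exact ht
  · exact absurd hC h.not_exNegative_hyp

namespace PTerm

/-- A typed term `u ∥ₐ v` reduces if `a` is active in `u` or not free in `u`. -/
theorem not_normal_em {Γ : Ctx L} {u v : PTerm L} {C : Formula L} (h : HasType Γ (em u v) C)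
    (hu : u.ActiveOrAbsent 0) : ¬ (em u v).Normal := by
  intro hn
  cases h with
  | em1 hP hQ h₁ h₂ =>
    -- In `u` the variable occurs only in hypothesis terms. If it occurs in none of those either,
    -- `u` is a lifted term and `v` can be dropped.
    have ho : u.OnlyHyp 0 := h₁.onlyHyp ⟨_, rfl⟩
    rcases hu with ⟨P, m, hact⟩ | hw
    · exact hn _ (.root (.emRaise u v P m hact ho (h₂.onlyWit ⟨_, rfl⟩)))
    · obtain ⟨u', hu'⟩ := exists_renH_skip ho hw
      exact hn _ (.root (.emDrop u u' v hu'.symm))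

/-- Shape of quasi-closed normal terms whose free proof-term variables have negative types. -/
theorem normal_shape {t : PTerm L} {Γ : Ctx L} {C : Formula L} {j : ℕ} (h : HasType Γ t C)
    (hn : t.Normal) (hq : t.QuasiClosedAt 0 j 0)
    (hΓ : ∀ x < j, ∀ B, Γ.vars[x]? = some B → B.Negative) :
    (∀ u v, t ≠ em u v) ∧ (t.Neutral → C.SimplyUniversal) ∧
      (C.ExNegative ∨ t.Neutral → ∀ a, t.ActiveOrAbsent a ∨ ∃ A, t = hyp a A) := by
  -- The three claims need each other: the first two force the head of an elimination to be neutral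
  -- of simply universal type, and the third, for `u`, refutes normality of `u ∥ₐ v`. The
  -- first-order bound stays `0` because the induction never has to enter a first-order binder,
  -- while `j` grows under `λx`.
  induction t generalizing Γ C j with
  | var x =>
    refine ⟨nofun, fun _ => ?_, fun _ a => Or.inl (Or.inr trivial)⟩
    cases h with | var h => exact (hΓ x hq _ h).simplyUniversal
  | hyp b A =>
    refine ⟨nofun, fun _ => ?_, fun _ a => ?_⟩
    · cases h with | hyp h hA => exact hA
    · by_cases hb : b = a
      · exact Or.inr ⟨A, by rw [hb]⟩
      · exact Or.inl (Or.inr hb)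
  | wit b P => exact absurd hq.2 (Nat.not_lt_zero _)
  | hyp0 P =>
    refine ⟨nofun, fun _ => ?_, fun _ a => Or.inl (Or.inr trivial)⟩
    cases h with
    | hyp0 h hP => exact hP.simplyUniversal
    | exfalso hP => exact Formula.Negative.simplyUniversal ⟨trivial, hP⟩
  | lam u ih =>
    refine ⟨nofun, nofun, ?_⟩
    rintro (hC | hC) a
    · cases h with
      | lam h =>
        rcases hC with hC | ⟨Q, -, hC⟩
        · have := (ih h (fun u' hu => hn _ (.lam hu)) hq ?_).2.2 (Or.inl (Or.inl hC.2)) a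
          · exact Or.inl (h.activeOrAbsent_of_exNegative (Or.inl hC.2) this)
          -- The new variable has the antecedent of a negative implication as its type, so it is
          -- negative too.
          · intro x hx B hB
            cases x with
            | zero => cases hB; exact hC.1
            | succ x => exact hΓ x (by omega) B hB
        · cases hC
    · exact hC.elim
  | pair t u ih₁ ih₂ =>
    refine ⟨nofun, nofun, ?_⟩
    rintro (hC | hC) a
    · cases h with
      | pair h₁ h₂ =>
        rcases hC with hC | ⟨Q, -, hC⟩
        · have e₁ := (ih₁ h₁ (fun u' hu => hn _ (.pairL _ hu)) hq.1 hΓ).2.2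
            (Or.inl (Or.inl hC.1)) a
          have e₂ := (ih₂ h₂ (fun u' hu => hn _ (.pairR _ hu)) hq.2 hΓ).2.2
            (Or.inl (Or.inl hC.2)) a
          exact Or.inl ((h₁.activeOrAbsent_of_exNegative (Or.inl hC.1) e₁).combine
            (h₂.activeOrAbsent_of_exNegative (Or.inl hC.2) e₂) (fun _ _ => id) And.intro)
        · cases hC
    · exact hC.elim
  | inl u | inr u | lamT u =>
    refine ⟨nofun, nofun, ?_⟩
    rintro ((hC | ⟨Q, -, rfl⟩) | hC) a
    · cases h; exact hC.elim
    · cases h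
    · exact hC.elim
  | enc m u ih =>
    refine ⟨nofun, nofun, ?_⟩
    rintro ((hC | ⟨Q, hQ, rfl⟩) | hC) a
    · cases h; exact hC.elim
    · cases h with
      | enc _ h =>
        have hQ' : (Q.inst m).Negative := hQ.subst _
        exact Or.inl (h.activeOrAbsent_of_exNegative (Or.inl hQ')
          ((ih h (fun u' hu => hn _ (.enc _ hu)) hq.2 hΓ).2.2 (Or.inl (Or.inl hQ')) a))
    · exact hC.elim
  | par u v ih₁ ih₂ =>
    refine ⟨nofun, nofun, ?_⟩
    rintro (hC | hC) a
    · cases h with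
      | em0 hP h₁ h₂ =>
        have e₁ := (ih₁ h₁ (fun u' hu => hn _ (.parL _ hu)) hq.1 hΓ).2.2 (Or.inl hC) a
        have e₂ := (ih₂ h₂ (fun u' hu => hn _ (.parR _ hu)) hq.2 hΓ).2.2 (Or.inl hC) a
        exact Or.inl ((h₁.activeOrAbsent_of_exNegative hC e₁).combine
          (h₂.activeOrAbsent_of_exNegative hC e₂) (fun _ _ => id) And.intro)
    · exact hC.elim
  | em u v ih₁ ih₂ =>
    refine absurd hn (not_normal_em h ?_)
    cases h with
    | @em1 _ _ _ P Q hP hQ h₁ h₂ =>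
      have hC : (Formula.ex Q).ExNegative := Or.inr ⟨Q, hQ, rfl⟩
      -- In `u` the variable `a` has universal type and may be counted as free, so `u` itself is
      -- quasi-closed and the induction hypothesis applies to it.
      have hq₁ := h₁.quasiClosedAt_of_succ hq.1 (h₁.onlyHyp ⟨_, rfl⟩)
      exact h₁.activeOrAbsent_of_exNegative hC
        ((ih₁ h₁ (fun u' hu => hn _ (.emL _ hu)) hq₁ hΓ).2.2 (Or.inl hC) 0)
  | app t u ih₁ ih₂ =>
    cases h with
    | app h₁ h₂ =>
      obtain ⟨hem, hsu, hact⟩ := ih₁ h₁ (fun u' hu => hn _ (.appL _ hu)) hq.1 hΓ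
      -- Any other head is a redex, permits a permutation, is excluded by the first claim, or has
      -- the wrong type for this elimination. The same analysis recurs for every elimination.
      have ht : t.Neutral := by
        cases t with
        | lam => exact (hn _ (.root (.beta _ _))).elim
        | par => exact (hn _ (.root (.parApp _ _ _))).elim
        | em => exact (hem _ _ rfl).elim
        | pair | inl | inr | lamT | enc => cases h₁
        | _ => trivial
      have hA := hsu ht
      refine ⟨nofun, fun _ => Formula.Negative.simplyUniversal hA.2, fun _ a => Or.inl ?_⟩
      have e₁ : t.ActiveOrAbsent a := (hact (Or.inr ht) a).resolve_right (by
        rintro ⟨A, rfl⟩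
        cases h₁)
      have e₂ := (ih₂ h₂ (fun u' hu => hn _ (.appR _ hu)) hq.2 hΓ).2.2
        (Or.inl (Or.inl hA.1)) a
      exact e₁.combine (h₂.activeOrAbsent_of_exNegative (Or.inl hA.1) e₂) (fun _ _ => id)
        And.intro
  | appT t m ih =>
    cases h with
    | @appT _ _ B _ h =>
      obtain ⟨hem, hsu, hact⟩ := ih h (fun u' hu => hn _ (.appT _ hu)) hq.1 hΓ
      have ht : t.Neutral := by
        cases t with
        | lamT => exact (hn _ (.root (.betaT _ _))).elim
        | par => exact (hn _ (.root (.parAppT _ _ _))).elim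
        | em => exact (hem _ _ rfl).elim
        | pair | inl | inr | lam | enc => cases h
        | _ => trivial
      refine ⟨nofun, fun _ => Formula.SimplyUniversal.subst (A := B) (hsu ht) _, fun _ a => Or.inl ?_⟩
      rcases hact (Or.inr ht) a with (⟨P, n, e⟩ | e) | ⟨A, rfl⟩
      · exact Or.inl ⟨P, n, Or.inr e⟩
      · exact Or.inr e
      -- Here the exceptional bare `H_a` meets its argument. Since no first-order variable is in
      -- scope, both the argument and `∀α A` are closed, so the subterm is active.
      · exact Or.inl ⟨A, m, Or.inl ⟨rfl, rfl, hq.2, hq.1.1⟩⟩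
  | fst t ih =>
    cases h with
    | fst h =>
      obtain ⟨hem, hsu, hact⟩ := ih h (fun u' hu => hn _ (.fst hu)) hq hΓ
      have ht : t.Neutral := by
        cases t with
        | pair => exact (hn _ (.root (.fst _ _))).elim
        | par => exact (hn _ (.root (.parFst _ _))).elim
        | em => exact (hem _ _ rfl).elim
        | lamT | inl | inr | lam | enc => cases h
        | _ => trivial
      have hA := hsu ht
      exact ⟨nofun, fun _ => Formula.Negative.simplyUniversal hA.1, fun _ a =>
        Or.inl (h.activeOrAbsent_of_exNegative (Or.inl hA) (hact (Or.inr ht) a))⟩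
  | snd t ih =>
    cases h with
    | snd h =>
      obtain ⟨hem, hsu, hact⟩ := ih h (fun u' hu => hn _ (.snd hu)) hq hΓ
      have ht : t.Neutral := by
        cases t with
        | pair => exact (hn _ (.root (.snd _ _))).elim
        | par => exact (hn _ (.root (.parSnd _ _))).elim
        | em => exact (hem _ _ rfl).elim
        | lamT | inl | inr | lam | enc => cases h
        | _ => trivial
      have hA := hsu ht
      exact ⟨nofun, fun _ => Formula.Negative.simplyUniversal hA.2, fun _ a =>
        Or.inl (h.activeOrAbsent_of_exNegative (Or.inl hA) (hact (Or.inr ht) a))⟩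
  | case t u v ih =>
    cases h with
    | case h =>
      obtain ⟨hem, hsu, -⟩ := ih h (fun u' hu => hn _ (.case₀ _ _ hu)) hq.1 hΓ
      have ht : t.Neutral := by
        cases t with
        | inl => exact (hn _ (.root (.caseL _ _ _))).elim
        | inr => exact (hn _ (.root (.caseR _ _ _))).elim
        | par => exact (hn _ (.root (.parCase _ _ _ _))).elim
        | em => exact (hem _ _ rfl).elim
        | lamT | pair | lam | enc => cases h
        | _ => trivial
      -- A disjunction is never simply universal, so a case distinction cannot be normal here.
      exact (hsu ht).elim
  | dest t u ih =>
    cases h with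
    | dest h =>
      obtain ⟨hem, hsu, -⟩ := ih h (fun u' hu => hn _ (.destL _ hu)) hq.1 hΓ
      have ht : t.Neutral := by
        cases t with
        | enc => exact (hn _ (.root (.dest _ _ _))).elim
        | par => exact (hn _ (.root (.parDest _ _ _))).elim
        | em => exact (hem _ _ rfl).elim
        | lamT | pair | lam | inl | inr => cases h
        | _ => trivial
      -- Likewise, an existential formula is never simply universal.
      exact (hsu ht).elim

/-- An existential type leaves pairs, parallel compositions, EM₁⁻ terms and neutral terms.
`normal_shape` excludes the last two, and the branches of a composition are proofs of the same
formula. -/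
theorem herbrandNF_of_normal {t : PTerm L} {Γ : Ctx L} {A : Formula L}
    (h : HasType Γ t (Formula.ex A)) (hn : t.Normal) (hq : t.QuasiClosed) : t.HerbrandNF := by
  induction t generalizing Γ with
  | enc m u => exact .enc m u hn
  | par u v ih₁ ih₂ =>
    cases h with
    | em0 hP h₁ h₂ =>
      exact .par u v (ih₁ h₁ (fun u' hu => hn _ (.parL _ hu)) hq.1)
        (ih₂ h₂ (fun u' hu => hn _ (.parR _ hu)) hq.2)
  | em u v => exact ((normal_shape (j := 0) h hn hq (fun _ hx => by omega)).1 u v rfl).elim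
  | lam | lamT | pair | inl | inr => cases h
  | _ => exact ((normal_shape (j := 0) h hn hq (fun _ hx => by omega)).2.1 trivial).elim

theorem HerbrandNF.witnesses_ne_nil {t : PTerm L} (h : t.HerbrandNF) : t.witnesses ≠ [] := by
  induction h with
  | enc m u h => exact List.cons_ne_nil _ _
  | par u v hu hv ih _ => exact List.append_ne_nil_of_left_ne_nil ih _

end PTerm

end NormalForms

/-! ### From a Herbrand normal form to a proof of the disjunction. -/

section Disjunctions

variable {L : FirstOrder.Language.{u, v}}

/-- Disjunctions nest to the right, so appending changes the innermost disjunct, and the proof must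
be rebuilt by case distinctions down the list. -/
theorem HasType.exists_disj_append_right {l l' : List (Formula L)} (hl : l ≠ []) {Γ : Ctx L}
    {s : PTerm L} (h : HasType Γ s (Formula.disj l)) :
    ∃ s', HasType Γ s' (Formula.disj (l ++ l')) := by
  induction l generalizing Γ s with
  | nil => exact absurd rfl hl
  | cons A l ih =>
    cases l with
    | nil =>
      cases l' with
      | nil => exact ⟨s, h⟩
      | cons B l' => exact ⟨s.inl, .inl h⟩
    | cons B l =>
      -- The induction hypothesis is applied to the variable that the second branch of the case
      -- distinction binds.
      obtain ⟨s', hs'⟩ := ih (List.cons_ne_nil _ _)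
        (Γ := Γ.addVar (Formula.disj (B :: l))) (s := PTerm.var 0) (.var rfl)
      exact ⟨PTerm.case s (PTerm.var 0).inl s'.inr, .case h (.inl (.var rfl)) (.inr hs')⟩

theorem HasType.exists_disj_append_left {l l' : List (Formula L)} (hl' : l' ≠ []) {Γ : Ctx L}
    {s : PTerm L} (h : HasType Γ s (Formula.disj l')) :
    ∃ s', HasType Γ s' (Formula.disj (l ++ l')) := by
  induction l with
  | nil => exact ⟨s, h⟩
  | cons A l ih =>
    obtain ⟨s', hs'⟩ := ih
    -- A proper disjunction arises only when the tail is nonempty, so its head is exposed before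
    -- injecting.
    obtain ⟨B, r, e⟩ := List.exists_cons_of_ne_nil
      (List.append_ne_nil_of_right_ne_nil l hl')
    rw [e] at hs'
    rw [List.cons_append, e]
    exact ⟨s'.inr, .inr hs'⟩

/-- The component of a leaf may use the EM₀ assumptions of its branch. Each branch proves its own
part of the disjunction, both parts are extended to the full list, and the same EM₀ inference
discharges the assumptions. -/
theorem PTerm.HerbrandNF.exists_disj {t : PTerm L} (ht : t.HerbrandNF) {Γ : Ctx L}
    {A : Formula L} (h : HasType Γ t (Formula.ex A)) :
    ∃ s, HasType Γ s (Formula.disj (t.witnesses.map fun m => A.inst m)) := by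
  induction ht generalizing Γ with
  | enc m u hn => cases h with | enc _ h => exact ⟨u, h⟩
  | par u v hu hv ih₁ ih₂ =>
    cases h with
    | em0 hP h₁ h₂ =>
      obtain ⟨s₁, hs₁⟩ := ih₁ h₁
      obtain ⟨s₂, hs₂⟩ := ih₂ h₂
      obtain ⟨s₁', hs₁'⟩ := hs₁.exists_disj_append_right
        (l' := v.witnesses.map fun m => A.inst m) (by simpa using hu.witnesses_ne_nil)
      obtain ⟨s₂', hs₂'⟩ := hs₂.exists_disj_append_left
        (l := u.witnesses.map fun m => A.inst m) (by simpa using hv.witnesses_ne_nil)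
      rw [← List.map_append] at hs₁' hs₂'
      exact ⟨PTerm.par s₁' s₂', .em0 hP hs₁' hs₂'⟩

end Disjunctions

end ILEM

theorem mainTheorem1 {L : FirstOrder.Language.{u, v}} (Γ : ILEM.Ctx L) (A : ILEM.Formula L)
    (hA : (ILEM.Formula.ex A).Closed) (t t' : ILEM.PTerm L) (hq : t.QuasiClosed)
    (ht : ILEM.HasType Γ t (ILEM.Formula.ex A)) (hred : t.Reduces t') (hnf : t'.Normal) :
    ILEM.HasType Γ t' (ILEM.Formula.ex A) ∧
    t'.HerbrandNF ∧
    t'.witnesses ≠ [] ∧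
    ∃ s : ILEM.PTerm L,
      ILEM.HasType Γ s (ILEM.Formula.disj (t'.witnesses.map fun m => A.inst m)) := by
  have ht' := ht.reduces hred
  have hH := ILEM.PTerm.herbrandNF_of_normal ht' hnf (hq.reduces hred)
  exact ⟨ht', hH, hH.witnesses_ne_nil, hH.exists_disj ht'⟩
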